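/- Let $\lambda_0,\lambda_1>0$ and let $\varepsilon(t)\in\{0,1\}$, $t\ge 0$, be a two-state continuous-time Markov chain that leaves state $j$ at rate $\lambda_j$: given $\varepsilon(0)=i$, the successive holding times are independent, the one following $n$ switchings being exponential with rate $\lambda_j$, where $j=i$ for even $n$ and $j=1-i$ for odd $n$. Let $\mathrm P_i$ be the conditional probability given $\varepsilon(0)=i$ (for $i$ with $\mathrm P\{\varepsilon(0)=i\}>0$), let $N(t)$ be the number of switchings up to time $t$, and for real velocities $\gamma_0,\gamma_1$ let $$\Gamma(t)=\int_0^t\gamma_{\varepsilon(s)}\,ds,\qquad T(y)=\min\{t>0:\Gamma(t)=y\}\quad(\min\emptyset=\infty).$$ For $\gamma_0>\gamma_1$ put $$\xi_0(t,x)=\frac{x-\gamma_1t}{\gamma_0-\gamma_1},\qquad \xi_1(t,x)=\frac{\gamma_0t-x}{\gamma_0-\gamma_1},\qquad z(t,x)=\lambda_0\lambda_1\xi_0(t,x)\xi_1(t,x),$$ $$\theta(t,x)=\frac{e^{-\lambda_0\xi_0(t,x)-\lambda_1\xi_1(t,x)}}{\gamma_0-\gamma_1},\qquad \mathcal I_0(t,x)=\sum_{n\ge0}\frac{z(t,x)^n}{n!^2},\qquad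 \mathcal I_1(t,x)=\sum_{n\ge0}\frac{z(t,x)^n}{n!(n+1)!}$$ (so that $\mathcal I_0=I_0(2\sqrt z)$ and $\mathcal I_1=I_1(2\sqrt z)/\sqrt z$ for $z>0$, with the modified Bessel functions $I_0,I_1$). Let $F_i(dt,y;n)=\mathrm P_i\{T(y)\in dt,\ N(T(y))=n\}$ and $F_i(dt,y)=\mathrm P_i\{T(y)\in dt\}$, as measures on the finite times, and let $f_i(t,y;n)$, $n\ge1$, be the density of $F_i(dt,y;n)$ with respect to Lebesgue measure; its existence is part of the claim. Let $\delta_a$ be the unit mass at $a$. (1) Let $\gamma_0>\gamma_1>0$ and $y>0$, or $\gamma_1<\gamma_0<0$ and $y<0$, and let $\Delta(y)$ be the closed segment with end points $y/\gamma_0$ and $y/\gamma_1$. Then $T(y)$ is a.s. bounded, $\mathrm P\{T(y)\in\Delta(y)\}=1$, and for each $i\in\{0,1\}$ the support of the distribution of $T(y)$ under $\mathrm P_i$ is $\Delta(y)$. Moreover, for $i\in\{0,1\}$ and $n\ge0$, $$F_i(dt,y;0)=e^{-\lambda_iy/\gamma_i}\delta_{y/\gamma_i}(dt),$$ $$f_i(t,y;2n+1)=\lambda_i|\gamma_{1-i}|\frac{z(t,y)^n}{n!^2}\theta(t,y)\mathbf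 1_{\{t\in\Delta(y)\}},\qquad f_i(t,y;2n+2)=\lambda_0\lambda_1|\gamma_i|\xi_i(t,y)\frac{z(t,y)^n}{n!(n+1)!}\theta(t,y)\mathbf 1_{\{t\in\Delta(y)\}},$$ $$F_i(dt,y)=e^{-\lambda_iy/\gamma_i}\delta_{y/\gamma_i}(dt)+\lambda_i\Big(|\gamma_{1-i}|\mathcal I_0(t,y)+\lambda_{1-i}|\gamma_i|\xi_i(t,y)\mathcal I_1(t,y)\Big)\theta(t,y)\mathbf 1_{\{t\in\Delta(y)\}}\,dt.$$ (2) If $y<0<\gamma_1\le\gamma_0$ or $y>0>\gamma_0\ge\gamma_1$, then $T(y)=\infty$ a.s. (3) Let $\gamma_0>0>\gamma_1$ and $y>0$. Then $F_0(dt,y;0)=e^{-\lambda_0y/\gamma_0}\delta_{y/\gamma_0}(dt)$, $F_1(dt,y;0)=0$, and for all $n\ge0$ $$f_0(t,y;2n+1)\equiv0,\qquad f_1(t,y;2n+2)\equiv0,$$ $$f_1(t,y;2n+1)=\frac{\lambda_1}{\xi_0(t,y)}\cdot\frac{z(t,y)^n}{n!^2}\,\theta(t,y)\Big(y-\frac{\gamma_1}{n+1}\xi_1(t,y)\Big)\mathbf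 1_{\{t>y/\gamma_0\}},$$ $$f_0(t,y;2n+2)=\lambda_0\lambda_1\,y\,\frac{z(t,y)^n}{n!(n+1)!}\,\theta(t,y)\,\mathbf 1_{\{t>y/\gamma_0\}}.$$ -/

import Mathlib

open MeasureTheory ProbabilityTheory

/-- The state of a two-state alternating process after `n` switchings, when it starts from `i`. -/
def stateAfter (i : Fin 2) (n : ℕ) : Fin 2 := if Even n then i else 1 - i

section Chain

variable {Ω : Type*} [MeasurableSpace Ω]

/-- The conditional probability `P_i` given the initial state `ε(0) = i`. -/
noncomputable def condStart (P : Measure Ω) (ε : ℝ → Ω → Fin 2) (i : Fin 2) : Measure Ω :=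
  ProbabilityTheory.cond P {ω | ε 0 ω = i}

/-- `ε(t)`, `t ≥ 0`, is a two-state continuous-time Markov chain on `{0, 1}`, which leaves the state
`j` at the rate `lam j`, and `τ 1 < τ 2 < …` are its switching times (`τ 0 = 0`). This is the
jump/holding-time definition of the chain: given the initial state `i`, the successive holding times
are independent, the holding time that follows `n` switchings is exponential with the rate of the
state then occupied, and the path is constant between switchings and changes state at each of them.
The initial distribution is arbitrary. -/
structure IsSwitchingProcess (P : Measure Ω) (lam : Fin 2 → ℝ) (ε : ℝ → Ω → Fin 2)
    (τ : ℕ → Ω → ℝ) : Prop where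
  measurable_state : ∀ t, 0 ≤ t → Measurable (ε t)
  measurable_time : ∀ n, Measurable (τ n)
  time_zero : ∀ᵐ ω ∂P, τ 0 ω = 0
  state_eq : ∀ᵐ ω ∂P, ∀ (n : ℕ) (t : ℝ), τ n ω ≤ t → t < τ (n + 1) ω →
    ε t ω = stateAfter (ε 0 ω) n
  indep : ∀ i : Fin 2, P {ω | ε 0 ω = i} ≠ 0 →
    iIndepFun (fun (n : ℕ) (ω : Ω) => τ (n + 1) ω - τ n ω) (condStart P ε i)
  law : ∀ i : Fin 2, P {ω | ε 0 ω = i} ≠ 0 → ∀ n : ℕ,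
    (condStart P ε i).map (fun ω => τ (n + 1) ω - τ n ω) = expMeasure (lam (stateAfter i n))

end Chain

section Paths

variable {Ω : Type*}

/-- `N(t)`: the number of switchings that occur up to the time `t`. -/
noncomputable def switchCount (τ : ℕ → Ω → ℝ) (t : ℝ) (ω : Ω) : ℕ∞ :=
  {n : ℕ | τ (n + 1) ω ≤ t}.encard

/-- The telegraph process `Γ(t) = ∫₀ᵗ γ_{ε(s)} ds`. -/
noncomputable def telegraph (γ : Fin 2 → ℝ) (ε : ℝ → Ω → Fin 2) (t : ℝ) (ω : Ω) : ℝ :=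
  ∫ s in (0 : ℝ)..t, γ (ε s ω)

/-- The first passage time `T(y)`, equal to `⊤ = ∞` if the level `y` is never reached. -/
noncomputable def firstPassage (γ : Fin 2 → ℝ) (ε : ℝ → Ω → Fin 2) (y : ℝ) (ω : Ω) : EReal :=
  sInf ((fun t : ℝ => (t : EReal)) '' {t : ℝ | 0 < t ∧ telegraph γ ε t ω = y})

/-- The event `{T(y) ∈ A}`, for a set `A` of finite times. -/
def passageIn (γ : Fin 2 → ℝ) (ε : ℝ → Ω → Fin 2) (y : ℝ) (A : Set ℝ) : Set Ω :=
  {ω | ∃ t ∈ A, firstPassage γ ε y ω = (t : EReal)}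

/-- The event `{T(y) ∈ A, N(T(y)) = n}`, for a set `A` of finite times. -/
def passageInWith (γ : Fin 2 → ℝ) (ε : ℝ → Ω → Fin 2) (τ : ℕ → Ω → ℝ) (y : ℝ) (A : Set ℝ)
    (n : ℕ) : Set Ω :=
  {ω | ∃ t ∈ A, firstPassage γ ε y ω = (t : EReal) ∧ switchCount τ t ω = (n : ℕ∞)}

end Paths

/-- `ξ₀(t, x) = (x - γ₁ t) / (γ₀ - γ₁)` and `ξ₁(t, x) = (γ₀ t - x) / (γ₀ - γ₁)`. -/
noncomputable def xi (γ : Fin 2 → ℝ) (i : Fin 2) (t x : ℝ) : ℝ :=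
  ![(x - γ 1 * t) / (γ 0 - γ 1), (γ 0 * t - x) / (γ 0 - γ 1)] i

/-- `z(t, x) = λ₀ λ₁ ξ₀(t, x) ξ₁(t, x)`. -/
noncomputable def zfun (lam γ : Fin 2 → ℝ) (t x : ℝ) : ℝ :=
  lam 0 * lam 1 * xi γ 0 t x * xi γ 1 t x

/-- `θ(t, x) = exp(-λ₀ ξ₀(t, x) - λ₁ ξ₁(t, x)) / (γ₀ - γ₁)`. -/
noncomputable def theta (lam γ : Fin 2 → ℝ) (t x : ℝ) : ℝ :=
  Real.exp (-lam 0 * xi γ 0 t x - lam 1 * xi γ 1 t x) / (γ 0 - γ 1)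

/-- `𝓘₀ = ∑ zⁿ / n!²` (which is `I₀(2√z)` for the modified Bessel function `I₀`). -/
noncomputable def besselSum0 (z : ℝ) : ℝ := ∑' n : ℕ, z ^ n / (n.factorial : ℝ) ^ 2

/-- `𝓘₁ = ∑ zⁿ / (n! (n+1)!)` (which is `I₁(2√z) / √z` for the modified Bessel function `I₁`). -/
noncomputable def besselSum1 (z : ℝ) : ℝ :=
  ∑' n : ℕ, z ^ n / ((n.factorial : ℝ) * ((n + 1).factorial : ℝ))

/-!
A path of the chain is determined by its sequence `d` of holding times, and the telegraph process
is affine on each holding interval. For a positive level `y` and nonzero velocities, the first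
passage happens after exactly `n` switchings if and only if the first `n` turning points lie below
`y` and the next one lies above it; this fails only when a turning point hits `y`, which has
probability zero. This description (`IsRegularPath.mem_passageInWith_iff`) turns
`{T(y) ∈ A, N(T(y)) = n}` into an event `passageEvent` of holding times, whose law `holdingLaw` is
a product of exponential laws.

Conditioning on the first holding time `s` gives the Markov recursion
`holdingLaw_passageEvent_succ`: the state is flipped, the level is lowered by `γ i * s` and the
number of switchings drops by one. In the coordinates `p = ξ_i`, `q = ξ_{1-i}` (the times spent in
the two states up to the passage) this replaces `p` by `p - s` and leaves `q` alone, and apart from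
the factor `θ`, which absorbs the exponential density, all densities are polynomials in `p`. Each
step is thus the integral of a polynomial
(`lintegral_exponentialPDF_mul_of_hasDerivAt`), and the closed forms follow by induction on `n`.
For velocities of one sign the integral over `p` starts at `0`. For opposite signs the level may
already be reached during the first holding time, so the integral from the state `0` starts at the
value `ℓ` of `p` with `γ 0 * ℓ + γ 1 * q = 0`, where the antiderivative
`p ^ m / (m + 1) * (γ 0 * p + γ 1 * q)` vanishes.

For velocities of the same sign the chain does not explode (second Borel-Cantelli lemma), so the
level is reached after finitely many switchings and summing over `n` yields the Bessel series.
Negative velocities are reduced to positive ones by the reflection `(γ, y) ↦ (-γ, -y)`; for this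
reason the formulas are proved with `|γ 0 - γ 1|` and no order between the velocities.
-/

/-! ### Holding times -/

theorem stateAfter_zero (i : Fin 2) : stateAfter i 0 = i := by simp [stateAfter]

theorem stateAfter_succ (i : Fin 2) (n : ℕ) : stateAfter i (n + 1) = stateAfter (1 - i) n := by
  by_cases h : Even n <;> simp [stateAfter, Nat.even_add_one, h]

/-- The displacement accumulated over the first `n` holding times `d 0, …, d (n - 1)`, for a path
which starts in the state `i`. -/
noncomputable def pathSum (γ : Fin 2 → ℝ) (i : Fin 2) (d : ℕ → ℝ) (n : ℕ) : ℝ :=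
  ∑ k ∈ Finset.range n, γ (stateAfter i k) * d k

/-- The holding-time sequences for which the level `y` is strictly above all turning points up to
the `n`-th and is crossed during the holding time that follows the `n`-th switching, at a time in
`A`. The turning point of index `0` is the origin, so the event is empty unless `0 < y`. -/
def passageEvent (γ : Fin 2 → ℝ) (n : ℕ) (i : Fin 2) (y : ℝ) (A : Set ℝ) : Set (ℕ → ℝ) :=
  {d | (∀ k ≤ n, pathSum γ i d k < y) ∧ y < pathSum γ i d (n + 1) ∧
    ∑ k ∈ Finset.range n, d k + (y - pathSum γ i d n) / γ (stateAfter i n) ∈ A}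

/-- The law of the sequence of holding times of the chain started from `i`. -/
noncomputable def holdingLaw (lam : Fin 2 → ℝ) (i : Fin 2) : Measure (ℕ → ℝ) :=
  Measure.infinitePi fun n => expMeasure (lam (stateAfter i n))

/-- The sequence `s, d 0, d 1, …`. -/
def consSeq (s : ℝ) (d : ℕ → ℝ) (n : ℕ) : ℝ := Nat.casesOn n s d

@[simp] theorem consSeq_zero (s : ℝ) (d : ℕ → ℝ) : consSeq s d 0 = s := rfl

@[simp] theorem consSeq_succ (s : ℝ) (d : ℕ → ℝ) (n : ℕ) : consSeq s d (n + 1) = d n := rfl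

theorem measurable_consSeq : Measurable fun x : ℝ × (ℕ → ℝ) => consSeq x.1 x.2 := by
  refine measurable_pi_lambda _ fun n => ?_
  cases n with
  | zero => exact measurable_fst
  | succ n => exact (measurable_pi_apply n).comp measurable_snd

theorem pathSum_zero (γ : Fin 2 → ℝ) (i : Fin 2) (d : ℕ → ℝ) : pathSum γ i d 0 = 0 := by
  simp [pathSum]

theorem pathSum_succ (γ : Fin 2 → ℝ) (i : Fin 2) (d : ℕ → ℝ) (n : ℕ) :
    pathSum γ i d (n + 1) = pathSum γ i d n + γ (stateAfter i n) * d n := by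
  simp [pathSum, Finset.sum_range_succ]

theorem pathSum_consSeq_succ (γ : Fin 2 → ℝ) (i : Fin 2) (s : ℝ) (d : ℕ → ℝ) (n : ℕ) :
    pathSum γ i (consSeq s d) (n + 1) = γ i * s + pathSum γ (1 - i) d n := by
  simp [pathSum, Finset.sum_range_succ', stateAfter_succ, stateAfter_zero, add_comm]

theorem measurable_pathSum (γ : Fin 2 → ℝ) (i : Fin 2) (n : ℕ) :
    Measurable fun d => pathSum γ i d n := by
  unfold pathSum; fun_prop

theorem measurableSet_passageEvent (γ : Fin 2 → ℝ) (n : ℕ) (i : Fin 2) (y : ℝ) {A : Set ℝ}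
    (hA : MeasurableSet A) : MeasurableSet (passageEvent γ n i y A) := by
  have hm := measurable_pathSum γ i
  have h1 : MeasurableSet {d : ℕ → ℝ | ∀ k ≤ n, pathSum γ i d k < y} := by
    simp only [Set.ofPred_forall]
    exact MeasurableSet.iInter fun k => MeasurableSet.iInter fun _ =>
      measurableSet_lt (hm k) measurable_const
  refine h1.inter ((measurableSet_lt measurable_const (hm (n + 1))).inter ?_)
  have : Measurable fun d : ℕ → ℝ =>
      ∑ k ∈ Finset.range n, d k + (y - pathSum γ i d n) / γ (stateAfter i n) := by
    have := hm n
    fun_prop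
  exact this hA

theorem passageEvent_of_nonpos (γ : Fin 2 → ℝ) (n : ℕ) (i : Fin 2) {y : ℝ} (hy : y ≤ 0)
    (A : Set ℝ) : passageEvent γ n i y A = ∅ := by
  ext d
  simp only [passageEvent, Set.mem_ofPred_eq, Set.mem_empty_iff_false, iff_false]
  rintro ⟨h, -⟩
  have := h 0 n.zero_le
  rw [pathSum_zero] at this
  linarith

/-- The Markov property at the first switching, at the level of holding times. -/
theorem consSeq_mem_passageEvent_succ (γ : Fin 2 → ℝ) (n : ℕ) (i : Fin 2) {y : ℝ} (hy : 0 < y)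
    (A : Set ℝ) (s : ℝ) (d : ℕ → ℝ) :
    consSeq s d ∈ passageEvent γ (n + 1) i y A ↔
      d ∈ passageEvent γ n (1 - i) (y - γ i * s) ((fun t => t + s) ⁻¹' A) := by
  have h0 : (∀ k ≤ n + 1, pathSum γ i (consSeq s d) k < y) ↔
      ∀ k ≤ n, pathSum γ (1 - i) d k < y - γ i * s := by
    constructor
    · intro h k hk
      have := h (k + 1) (by omega)
      rw [pathSum_consSeq_succ] at this
      linarith
    · intro h k hk
      cases k with
      | zero => rwa [pathSum_zero]
      | succ k =>
        have := h k (by omega)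
        rw [pathSum_consSeq_succ]
        linarith
  simp only [passageEvent, Set.mem_ofPred_eq, h0, pathSum_consSeq_succ, stateAfter_succ,
    Set.mem_preimage, Finset.sum_range_succ', consSeq_succ, consSeq_zero]
  rw [sub_lt_iff_lt_add', show ∑ k ∈ Finset.range n, d k + s +
    (y - (γ i * s + pathSum γ (1 - i) d n)) / γ (stateAfter (1 - i) n) =
    ∑ k ∈ Finset.range n, d k + (y - γ i * s - pathSum γ (1 - i) d n) /
      γ (stateAfter (1 - i) n) + s by ring]

section Law

variable {lam : Fin 2 → ℝ}

theorem isProbabilityMeasure_holdingLaw (hlam : ∀ i, 0 < lam i) (i : Fin 2) :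
    IsProbabilityMeasure (holdingLaw lam i) := by
  have : ∀ n, IsProbabilityMeasure (expMeasure (lam (stateAfter i n))) :=
    fun n => isProbabilityMeasure_expMeasure (hlam _)
  unfold holdingLaw; infer_instance

theorem map_eval_holdingLaw (hlam : ∀ i, 0 < lam i) (i : Fin 2) (n : ℕ) :
    (holdingLaw lam i).map (fun d => d n) = expMeasure (lam (stateAfter i n)) := by
  have : ∀ n, IsProbabilityMeasure (expMeasure (lam (stateAfter i n))) :=
    fun n => isProbabilityMeasure_expMeasure (hlam _)
  exact Measure.infinitePi_map_eval (fun n => expMeasure (lam (stateAfter i n))) n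

/-- The first holding time is independent of the later ones, which follow the law of the chain
started from the other state. -/
theorem holdingLaw_eq_map_consSeq (hlam : ∀ i, 0 < lam i) (i : Fin 2) :
    holdingLaw lam i = ((expMeasure (lam i)).prod (holdingLaw lam (1 - i))).map
      (fun x => consSeq x.1 x.2) := by
  have h1 : ∀ i n, IsProbabilityMeasure (expMeasure (lam (stateAfter i n))) :=
    fun i n => isProbabilityMeasure_expMeasure (hlam _)
  have h2 := isProbabilityMeasure_expMeasure (hlam i)
  have h3 := isProbabilityMeasure_holdingLaw hlam (1 - i)
  symm
  refine Measure.eq_infinitePi _ fun s t ht => ?_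
  -- complete the box by full factors so that it runs over an initial segment of indices
  classical
  obtain ⟨N, hN⟩ : ∃ N, s ⊆ Finset.range (N + 1) :=
    ⟨s.sup id, fun k hk => Finset.mem_range.2 (Nat.lt_succ_of_le (Finset.le_sup (f := id) hk))⟩
  set u : ℕ → Set ℝ := fun k => if k ∈ s then t k else Set.univ with hu
  have hum : ∀ k, MeasurableSet (u k) := fun k => by
    by_cases h : k ∈ s <;> simp [hu, h, ht]
  have hset : (s : Set ℕ).pi t = ((Finset.range (N + 1) : Finset ℕ) : Set ℕ).pi u := by
    ext d
    simp only [Set.mem_pi, Finset.mem_coe, hu]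
    constructor
    · intro h k _
      by_cases hk : k ∈ s <;> simp [hk, h]
    · intro h k hk
      simpa [hk] using h k (hN hk)
  have hprod : ∏ k ∈ s, expMeasure (lam (stateAfter i k)) (t k) =
      ∏ k ∈ Finset.range (N + 1), expMeasure (lam (stateAfter i k)) (u k) := by
    rw [← Finset.prod_subset hN (f := fun k => expMeasure (lam (stateAfter i k)) (u k))]
    · exact Finset.prod_congr rfl fun k hk => by simp [hu, hk]
    · intro k _ hk
      simp [hu, hk]
  rw [hset, hprod, Measure.map_apply measurable_consSeq
    (MeasurableSet.pi (Finset.countable_toSet _) fun k _ => hum k)]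
  have hpre : (fun x : ℝ × (ℕ → ℝ) => consSeq x.1 x.2) ⁻¹'
      ((Finset.range (N + 1) : Finset ℕ) : Set ℕ).pi u =
      u 0 ×ˢ ((Finset.range N : Finset ℕ) : Set ℕ).pi (fun k => u (k + 1)) := by
    ext ⟨a, d⟩
    simp only [Set.mem_preimage, Set.mem_pi, Finset.mem_coe, Finset.mem_range, Set.mem_prod]
    constructor
    · exact fun h => ⟨h 0 (by omega), fun k hk => h (k + 1) (by omega)⟩
    · rintro ⟨h0, h⟩ k hk
      cases k with
      | zero => exact h0
      | succ k => exact h k (by omega)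
  rw [hpre, Measure.prod_prod, holdingLaw, Measure.infinitePi_pi _ (fun k _ => hum _),
    Finset.prod_range_succ', mul_comm]
  simp [stateAfter_succ, stateAfter_zero]

theorem holdingLaw_passageEvent_succ (hlam : ∀ i, 0 < lam i) (γ : Fin 2 → ℝ) (n : ℕ) (i : Fin 2)
    {y : ℝ} (hy : 0 < y) {A : Set ℝ} (hA : MeasurableSet A) :
    holdingLaw lam i (passageEvent γ (n + 1) i y A) = ∫⁻ s, exponentialPDF (lam i) s *
      holdingLaw lam (1 - i)
        (passageEvent γ n (1 - i) (y - γ i * s) ((fun t => t + s) ⁻¹' A)) := by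
  have h3 := isProbabilityMeasure_holdingLaw hlam (1 - i)
  have h2 := isProbabilityMeasure_expMeasure (hlam i)
  have hE := measurableSet_passageEvent γ (n + 1) i y hA
  rw [holdingLaw_eq_map_consSeq hlam i, Measure.map_apply measurable_consSeq hE,
    Measure.prod_apply (measurable_consSeq hE)]
  have hm := measurable_measure_prodMk_left (ν := holdingLaw lam (1 - i)) (measurable_consSeq hE)
  have : expMeasure (lam i) = volume.withDensity (exponentialPDF (lam i)) := rfl
  rw [this, lintegral_withDensity_eq_lintegral_mul _
    (by exact (measurable_exponentialPDFReal _).ennreal_ofReal) hm]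
  refine lintegral_congr fun s => ?_
  simp only [Pi.mul_apply]
  congr 2
  ext d
  exact consSeq_mem_passageEvent_succ γ n i hy A s d

theorem expMeasure_singleton (r a : ℝ) : expMeasure r {a} = 0 :=
  withDensity_absolutelyContinuous _ _ (measure_singleton a)

theorem expMeasure_Ioi {r x : ℝ} (hr : 0 < r) (hx : 0 ≤ x) :
    expMeasure r (Set.Ioi x) = ENNReal.ofReal (Real.exp (-(r * x))) := by
  have := isProbabilityMeasure_expMeasure hr
  have h : expMeasure r (Set.Iic x) = ENNReal.ofReal (1 - Real.exp (-(r * x))) := by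
    have h1 : expMeasure r (Set.Iic x) = ∫⁻ s in Set.Iic x, exponentialPDF r s :=
      withDensity_apply _ measurableSet_Iic
    rw [h1, lintegral_exponentialPDF_eq_antiDeriv hr, if_pos hx]
  rw [← Set.compl_Iic, measure_compl measurableSet_Iic (measure_ne_top _ _), h, measure_univ,
    ← ENNReal.ofReal_one, ← ENNReal.ofReal_sub _ (sub_nonneg.2 (Real.exp_le_one_iff.2 (by
      have := mul_nonneg hr.le hx
      linarith)))]
  simp

theorem expMeasure_Iic_zero {r : ℝ} (hr : 0 < r) : expMeasure r (Set.Iic 0) = 0 := by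
  have := isProbabilityMeasure_expMeasure hr
  rw [← prob_compl_eq_one_iff measurableSet_Iic, Set.compl_Iic, expMeasure_Ioi hr le_rfl]
  simp

theorem ae_holdingLaw_pos (hlam : ∀ i, 0 < lam i) (i : Fin 2) :
    ∀ᵐ d ∂holdingLaw lam i, ∀ n, 0 < d n := by
  refine ae_all_iff.2 fun n => ?_
  have h := expMeasure_Iic_zero (hlam (stateAfter i n))
  rw [← map_eval_holdingLaw hlam i n, Measure.map_apply (measurable_pi_apply n)
    measurableSet_Iic] at h
  rw [ae_iff]
  convert h using 2
  ext d
  simp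

/-- Almost surely no turning point lies on the level `y`. -/
theorem ae_holdingLaw_pathSum_ne (hlam : ∀ i, 0 < lam i) {γ : Fin 2 → ℝ} (hγ : ∀ i, γ i ≠ 0)
    (i : Fin 2) (y : ℝ) : ∀ᵐ d ∂holdingLaw lam i, ∀ n, pathSum γ i d (n + 1) ≠ y := by
  refine ae_all_iff.2 fun n => ?_
  have h3 := isProbabilityMeasure_holdingLaw hlam (1 - i)
  have h2 := isProbabilityMeasure_expMeasure (hlam i)
  have hE : MeasurableSet {d | ¬ pathSum γ i d (n + 1) ≠ y} := by
    simp only [not_not]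
    exact measurableSet_eq_fun (measurable_pathSum γ i (n + 1)) measurable_const
  rw [ae_iff, holdingLaw_eq_map_consSeq hlam i, Measure.map_apply measurable_consSeq hE,
    Measure.prod_apply_symm (measurable_consSeq hE), lintegral_eq_zero_iff'
      (measurable_measure_prodMk_right (measurable_consSeq hE)).aemeasurable]
  refine Filter.Eventually.of_forall fun d => ?_
  refine measure_mono_null (fun s hs => ?_)
    (expMeasure_singleton (lam i) ((y - pathSum γ (1 - i) d n) / γ i))
  simp only [Set.mem_preimage, Set.mem_ofPred_eq, not_not, pathSum_consSeq_succ] at hs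
  rw [Set.mem_singleton_iff, eq_div_iff (hγ i)]
  linarith

/-- The chain does not explode: infinitely many holding times exceed `1`. -/
theorem ae_holdingLaw_tendsto (hlam : ∀ i, 0 < lam i) (i : Fin 2) :
    ∀ᵐ d ∂holdingLaw lam i,
      Filter.Tendsto (fun n => ∑ k ∈ Finset.range n, d k) Filter.atTop Filter.atTop := by
  have h1 : ∀ n, IsProbabilityMeasure (expMeasure (lam (stateAfter i n))) :=
    fun n => isProbabilityMeasure_expMeasure (hlam _)
  have hP := isProbabilityMeasure_holdingLaw hlam i
  set S : ℕ → Set (ℕ → ℝ) := fun n => (fun d => d n) ⁻¹' Set.Ioi 1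
  have hSm : ∀ n, MeasurableSet (S n) := fun n => measurable_pi_apply n measurableSet_Ioi
  have hmeas : ∀ n, holdingLaw lam i (S n) =
      ENNReal.ofReal (Real.exp (-(lam (stateAfter i n) * 1))) := fun n => by
    rw [← expMeasure_Ioi (hlam _) zero_le_one, ← map_eval_holdingLaw hlam i n,
      Measure.map_apply (measurable_pi_apply n) measurableSet_Ioi]
  have hind : iIndepSet S (holdingLaw lam i) := by
    have := iIndepFun_infinitePi (P := fun n => expMeasure (lam (stateAfter i n)))
      (X := fun _ x => x) (fun _ => measurable_id)
    rw [iIndepSet_iff_meas_biInter hSm]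
    intro s
    exact this.meas_biInter fun k _ => ⟨Set.Ioi 1, measurableSet_Ioi, rfl⟩
  have hsum : ∑' n, holdingLaw lam i (S n) = ⊤ := by
    set c := ENNReal.ofReal (Real.exp (-(lam 0 + lam 1)))
    have hc : c ≠ 0 := by simp [c, Real.exp_pos]
    refine top_unique ((ENNReal.tsum_const_eq_top_of_ne_zero (α := ℕ) hc).symm.le.trans
      (ENNReal.tsum_le_tsum fun n => ?_))
    rw [hmeas]
    refine ENNReal.ofReal_le_ofReal (Real.exp_le_exp.2 ?_)
    have h0 := hlam 0
    have h1 := hlam 1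
    generalize stateAfter i n = j
    fin_cases j <;> simp <;> linarith
  have hlim := measure_limsup_eq_one hSm hind hsum
  have hlim' : ∀ᵐ d ∂holdingLaw lam i, d ∈ Filter.limsup S Filter.atTop :=
    (mem_ae_iff_prob_eq_one (MeasurableSet.measurableSet_limsup hSm)).2 hlim
  filter_upwards [hlim', ae_holdingLaw_pos hlam i] with d hd hpos
  rw [Filter.mem_limsup_iff_frequently_mem] at hd
  refine (not_summable_iff_tendsto_nat_atTop_of_nonneg fun n => (hpos n).le).1 fun hs => ?_
  have := hs.tendsto_atTop_zero.eventually (gt_mem_nhds (zero_lt_one' ℝ))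
  obtain ⟨n, hn, hn'⟩ := (hd.and_eventually this).exists
  exact lt_asymm hn hn'

end Law

/-! ### Time coordinates -/

theorem fin_two_sub_sub (i : Fin 2) : 1 - (1 - i) = i := by fin_cases i <;> rfl

section Coordinates

variable {lam γ : Fin 2 → ℝ}

theorem sub_ne_zero_of_velocity_ne (hne : γ 0 ≠ γ 1) (i : Fin 2) : γ i - γ (1 - i) ≠ 0 := by
  fin_cases i
  · exact sub_ne_zero.2 hne
  · exact sub_ne_zero.2 hne.symm

theorem abs_velocity_sub (i : Fin 2) : |γ i - γ (1 - i)| = |γ 0 - γ 1| := by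
  fin_cases i
  · rfl
  · exact abs_sub_comm _ _

theorem xi_eq (γ : Fin 2 → ℝ) (i : Fin 2) (t y : ℝ) :
    xi γ i t y = (y - γ (1 - i) * t) / (γ i - γ (1 - i)) := by
  fin_cases i
  · rfl
  · change (γ 0 * t - y) / (γ 0 - γ 1) = (y - γ 0 * t) / (γ 1 - γ 0)
    rw [← neg_div_neg_eq, neg_sub, neg_sub]

theorem xi_one_sub (γ : Fin 2 → ℝ) (i : Fin 2) (t y : ℝ) :
    xi γ (1 - i) t y = (γ i * t - y) / (γ i - γ (1 - i)) := by
  rw [xi_eq, fin_two_sub_sub, ← neg_div_neg_eq, neg_sub, neg_sub]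

theorem xi_sub_self (hne : γ 0 ≠ γ 1) (i : Fin 2) (t y s : ℝ) :
    xi γ i (t - s) (y - γ i * s) = xi γ i t y - s := by
  have := sub_ne_zero_of_velocity_ne hne i
  rw [xi_eq, xi_eq]
  field_simp
  ring

theorem xi_sub_other (i : Fin 2) (t y s : ℝ) :
    xi γ (1 - i) (t - s) (y - γ i * s) = xi γ (1 - i) t y := by
  rw [xi_one_sub, xi_one_sub]
  ring

theorem velocity_mul_xi_add (hne : γ 0 ≠ γ 1) (i : Fin 2) (t y : ℝ) :
    γ i * xi γ i t y + γ (1 - i) * xi γ (1 - i) t y = y := by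
  have := sub_ne_zero_of_velocity_ne hne i
  rw [xi_one_sub, xi_eq]
  field_simp
  ring

theorem xi_add_xi (hne : γ 0 ≠ γ 1) (i : Fin 2) (t y : ℝ) :
    xi γ i t y + xi γ (1 - i) t y = t := by
  have := sub_ne_zero_of_velocity_ne hne i
  rw [xi_one_sub, xi_eq]
  field_simp
  ring

theorem zfun_eq (lam γ : Fin 2 → ℝ) (i : Fin 2) (t y : ℝ) :
    zfun lam γ t y = lam 0 * lam 1 * (xi γ i t y * xi γ (1 - i) t y) := by
  fin_cases i
  · simp only [zfun]; exact mul_assoc _ _ _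
  · change _ = lam 0 * lam 1 * (xi γ 1 t y * xi γ 0 t y)
    simp only [zfun]
    ring

theorem rate_mul_rate (lam : Fin 2 → ℝ) (i : Fin 2) : lam i * lam (1 - i) = lam 0 * lam 1 := by
  fin_cases i
  · rfl
  · exact mul_comm _ _

/-- The variant of `θ` with the factor `|γ₀ - γ₁|⁻¹`, which does not depend on the order of the two
velocities. -/
noncomputable def absTheta (lam γ : Fin 2 → ℝ) (t y : ℝ) : ℝ :=
  Real.exp (-lam 0 * xi γ 0 t y - lam 1 * xi γ 1 t y) / |γ 0 - γ 1|

theorem absTheta_eq (lam γ : Fin 2 → ℝ) (i : Fin 2) (t y : ℝ) :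
    absTheta lam γ t y =
      Real.exp (-(lam i * xi γ i t y) - lam (1 - i) * xi γ (1 - i) t y) / |γ 0 - γ 1| := by
  fin_cases i
  · simp [absTheta]
  · simp only [absTheta]
    congr 2
    change _ = -(lam 1 * xi γ 1 t y) - lam 0 * xi γ 0 t y
    ring

theorem absTheta_pos (lam : Fin 2 → ℝ) (hne : γ 0 ≠ γ 1) (t y : ℝ) : 0 < absTheta lam γ t y :=
  div_pos (Real.exp_pos _) (abs_pos.2 (sub_ne_zero.2 hne))

theorem absTheta_sub (hne : γ 0 ≠ γ 1) (i : Fin 2) (t y s : ℝ) :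
    absTheta lam γ (t - s) (y - γ i * s) = absTheta lam γ t y * Real.exp (lam i * s) := by
  rw [absTheta_eq lam γ i, absTheta_eq lam γ i, xi_sub_self hne, xi_sub_other, div_mul_eq_mul_div,
    ← Real.exp_add]
  congr 2
  ring

theorem measurable_xi (γ : Fin 2 → ℝ) (i : Fin 2) :
    Measurable fun x : ℝ × ℝ => xi γ i x.1 x.2 := by
  simp only [xi_eq]
  fun_prop

theorem measurable_zfun (lam γ : Fin 2 → ℝ) : Measurable fun x : ℝ × ℝ => zfun lam γ x.1 x.2 := by
  unfold zfun
  exact ((measurable_xi γ 0).const_mul _).mul (measurable_xi γ 1)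

theorem measurable_absTheta (lam γ : Fin 2 → ℝ) :
    Measurable fun x : ℝ × ℝ => absTheta lam γ x.1 x.2 := by
  have h0 := measurable_xi γ 0
  have h1 := measurable_xi γ 1
  unfold absTheta
  fun_prop

theorem ae_xi_ne_zero (hne : γ 0 ≠ γ 1) {i : Fin 2} (hγ : γ (1 - i) ≠ 0) (y : ℝ) :
    ∀ᵐ t : ℝ, xi γ i t y ≠ 0 := by
  refine Measure.ae_ne volume (y / γ (1 - i)) |>.mono fun t ht h => ht ?_
  rw [xi_eq, div_eq_zero_iff, or_iff_left (sub_ne_zero_of_velocity_ne hne i)] at h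
  rw [eq_div_iff hγ]
  linarith

end Coordinates

/-! ### Transfer of densities across the first switching -/

/-- If the event from the other state has the density `F`, then the event with one more switching
has the density obtained by integrating over the first holding time. -/
theorem holdingLaw_passageEvent_succ_of_density {lam : Fin 2 → ℝ} (hlam : ∀ i, 0 < lam i)
    {γ : Fin 2 → ℝ} {n : ℕ} {i : Fin 2} {F : ℝ → ℝ → ENNReal}
    (hF : Measurable (Function.uncurry F))
    (hE : ∀ y A, MeasurableSet A →
      holdingLaw lam (1 - i) (passageEvent γ n (1 - i) y A) = ∫⁻ t in A, F t y)
    {y : ℝ} (hy : 0 < y) {A : Set ℝ} (hA : MeasurableSet A) :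
    holdingLaw lam i (passageEvent γ (n + 1) i y A) =
      ∫⁻ t in A, ∫⁻ s, exponentialPDF (lam i) s * F (t - s) (y - γ i * s) := by
  have hpdf : Measurable (exponentialPDF (lam i)) := (measurable_exponentialPDFReal _).ennreal_ofReal
  rw [holdingLaw_passageEvent_succ hlam γ n i hy hA]
  have hshift : ∀ s, ∫⁻ t in (fun t => t + s) ⁻¹' A, F t (y - γ i * s) =
      ∫⁻ t in A, F (t - s) (y - γ i * s) := fun s => by
    rw [← lintegral_indicator ((measurable_add_const s) hA), ← lintegral_indicator hA,
      ← lintegral_sub_right_eq_self _ s]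
    refine lintegral_congr fun t => ?_
    by_cases ht : t ∈ A <;> simp [ht]
  have hjoint : Measurable fun x : ℝ × ℝ =>
      exponentialPDF (lam i) x.1 * F (x.2 - x.1) (y - γ i * x.1) := by
    refine (hpdf.comp measurable_fst).mul (hF.comp (f := fun x : ℝ × ℝ =>
      (x.2 - x.1, y - γ i * x.1)) (by fun_prop))
  calc _ = ∫⁻ s, ∫⁻ t in A, exponentialPDF (lam i) s * F (t - s) (y - γ i * s) := by
        refine lintegral_congr fun s => ?_
        rw [hE _ _ ((measurable_add_const s) hA), hshift, lintegral_const_mul]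
        exact hF.comp (f := fun t : ℝ => (t - s, y - γ i * s)) (by fun_prop)
    _ = _ := lintegral_lintegral_swap hjoint.aemeasurable

/-- Integration over the first holding time `s`, in the variable `p - s` in which the densities are
polynomials up to a factor that cancels the exponential. The integral is cut off where `p - s`
falls to `ℓ`. -/
theorem lintegral_exponentialPDF_mul_of_hasDerivAt {r p ℓ : ℝ} (hr : 0 < r) {G H : ℝ → ℝ}
    {K : ℝ → ENNReal} (hH : ∀ x, HasDerivAt H (G x) x) (hG : Continuous G)
    (hpos : ∀ x, ℓ < x → x ≤ p → 0 ≤ G x)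
    (hK : ∀ s, 0 ≤ s → K s =
      ENNReal.ofReal (if ℓ < p - s then G (p - s) * Real.exp (r * s) else 0)) :
    ∫⁻ s, exponentialPDF r s * K s =
      ENNReal.ofReal (if ℓ < p then r * (H p - H ℓ) else 0) := by
  have hint : ∀ s, exponentialPDF r s * K s =
      (Set.Ico 0 (p - ℓ)).indicator (fun s => ENNReal.ofReal (r * G (p - s))) s := fun s => by
    rcases lt_or_ge s 0 with hs | hs
    · rw [exponentialPDF_of_neg hs, zero_mul, Set.indicator_of_notMem]
      exact fun h => absurd h.1 (not_le.2 hs)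
    · rw [exponentialPDF_of_nonneg hs, hK s hs]
      by_cases h : ℓ < p - s
      · rw [if_pos h, Set.indicator_of_mem (by constructor <;> linarith),
          ← ENNReal.ofReal_mul (by positivity)]
        congr 1
        have : Real.exp (-(r * s)) * Real.exp (r * s) = 1 := by
          rw [← Real.exp_add]; simp
        linear_combination r * G (p - s) * this
      · rw [if_neg h, ENNReal.ofReal_zero, mul_zero, Set.indicator_of_notMem]
        exact fun h' => h (by linarith [h'.2])
  rw [lintegral_congr hint, lintegral_indicator measurableSet_Ico]
  split_ifs with h
  · have hcont : Continuous fun s => r * G (p - s) := by fun_prop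
    have hle : (0 : ℝ) ≤ p - ℓ := by linarith
    rw [← setLIntegral_congr Ioo_ae_eq_Ico, setLIntegral_congr Ioo_ae_eq_Ioc,
      ← ofReal_integral_eq_lintegral_ofReal, ← intervalIntegral.integral_of_le hle]
    · congr 1
      have hd : ∀ s ∈ Set.uIcc 0 (p - ℓ),
          HasDerivAt (fun s => -(r * H (p - s))) (r * G (p - s)) s := fun s _ => by
        have := (((hH (p - s)).comp s ((hasDerivAt_id s).const_sub p)).const_mul r).fun_neg
        simpa using this
      rw [intervalIntegral.integral_eq_sub_of_hasDerivAt hd (hcont.intervalIntegrable _ _)]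
      simp only [sub_sub_cancel, sub_zero]
      ring
    · exact (hcont.integrableOn_Icc).mono_set Set.Ioc_subset_Icc_self
    · rw [← Measure.restrict_congr_set Ioo_ae_eq_Ioc]
      filter_upwards [ae_restrict_mem measurableSet_Ioo] with s hs
      exact mul_nonneg hr.le (hpos _ (by linarith [hs.2]) (by linarith [hs.1]))
  · rw [Set.Ico_eq_empty (by linarith)]
    simp

/-! ### No switching and one switching -/

theorem holdingLaw_passageEvent_zero {lam : Fin 2 → ℝ} (hlam : ∀ i, 0 < lam i) (γ : Fin 2 → ℝ)
    (i : Fin 2) {y : ℝ} (hy : 0 < y) (A : Set ℝ) :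
    holdingLaw lam i (passageEvent γ 0 i y A) = if 0 < γ i then
      ENNReal.ofReal (Real.exp (-lam i * (y / γ i))) * Measure.dirac (y / γ i) A else 0 := by
  have hset : passageEvent γ 0 i y A = {d | y < γ i * d 0 ∧ y / γ i ∈ A} := by
    ext d
    simp [passageEvent, pathSum, stateAfter_zero, hy]
  rw [hset]
  split_ifs with h
  · by_cases hA : y / γ i ∈ A
    · have : {d : ℕ → ℝ | y < γ i * d 0 ∧ y / γ i ∈ A} =
          (fun d => d 0) ⁻¹' Set.Ioi (y / γ i) := by
        ext d
        simp [hA, div_lt_iff₀' h]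
      rw [this, ← Measure.map_apply (measurable_pi_apply 0) measurableSet_Ioi,
        map_eval_holdingLaw hlam, stateAfter_zero, expMeasure_Ioi (hlam i) (by positivity),
        Measure.dirac_apply_of_mem hA, mul_one, neg_mul]
    · have h0 : Measure.dirac (y / γ i) A = 0 := by
        have := Measure.dirac_apply (y / γ i) A
        rw [this]
        simp [hA]
      simp [hA, h0]
  · refine measure_mono_null ?_ (ae_iff.1 (ae_holdingLaw_pos hlam i))
    rintro d ⟨hd, -⟩ hpos
    nlinarith [hpos 0, not_lt.1 h]

theorem lintegral_comp_affine {c : ℝ} (hc : c ≠ 0) (e : ℝ) {G : ℝ → ENNReal} (hG : Measurable G) :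
    ∫⁻ s, G s = ∫⁻ t, ENNReal.ofReal |c| * G (c * t + e) := by
  rw [← lintegral_add_right_eq_self G e]
  conv_lhs => rw [← Real.smul_map_volume_mul_left hc]
  rw [lintegral_smul_measure, lintegral_map (by fun_prop) (by fun_prop),
    lintegral_const_mul _ (by fun_prop), smul_eq_mul]

theorem holdingLaw_passageEvent_one {lam : Fin 2 → ℝ} (hlam : ∀ i, 0 < lam i) {γ : Fin 2 → ℝ}
    (hne : γ 0 ≠ γ 1) {i : Fin 2} (hγ : 0 < γ (1 - i)) {y : ℝ} (hy : 0 < y) {A : Set ℝ}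
    (hA : MeasurableSet A) :
    holdingLaw lam i (passageEvent γ 1 i y A) = ∫⁻ t in A, ENNReal.ofReal
      (if 0 < xi γ i t y ∧ 0 < xi γ (1 - i) t y then
        lam i * γ (1 - i) * absTheta lam γ t y else 0) := by
  have hγ' := hγ.ne'
  have hD := sub_ne_zero_of_velocity_ne hne i
  rw [holdingLaw_passageEvent_succ hlam γ 0 i hy hA]
  set b := γ (1 - i) with hb
  set G : ℝ → ENNReal := fun s => exponentialPDF (lam i) s * (if 0 < y - γ i * s then
    ENNReal.ofReal (Real.exp (-lam (1 - i) * ((y - γ i * s) / b))) *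
      A.indicator 1 ((y - γ i * s) / b + s) else 0) with hGdef
  have hpdf : Measurable (exponentialPDF (lam i)) := (measurable_exponentialPDFReal _).ennreal_ofReal
  have hGm : Measurable G := by
    refine hpdf.mul (Measurable.ite (measurableSet_lt measurable_const (by fun_prop)) ?_
      measurable_const)
    refine Measurable.mul (by fun_prop) ?_
    exact (measurable_one.indicator hA).comp (by fun_prop)
  have h1 : ∀ s, exponentialPDF (lam i) s * holdingLaw lam (1 - i)
      (passageEvent γ 0 (1 - i) (y - γ i * s) ((fun t => t + s) ⁻¹' A)) = G s := fun s => by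
    simp only [hGdef]
    congr 1
    split_ifs with h
    · rw [holdingLaw_passageEvent_zero hlam γ (1 - i) h, if_pos hγ,
        Measure.dirac_apply' _ ((measurable_add_const s) hA)]
      rfl
    · rw [passageEvent_of_nonpos γ 0 _ (not_lt.1 h), measure_empty]
  have hc : -b / (γ i - b) ≠ 0 := div_ne_zero (neg_ne_zero.2 hγ') hD
  -- the switching time `s` is the occupation time `ξ_i` of the passage time `t`
  rw [lintegral_congr h1, lintegral_comp_affine hc (y / (γ i - b)) hGm, ← lintegral_indicator hA]
  refine lintegral_congr_ae ?_
  filter_upwards [ae_xi_ne_zero hne hγ' y] with t ht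
  have hs : -b / (γ i - b) * t + y / (γ i - b) = xi γ i t y := by
    rw [xi_eq]; ring
  have hq : (y - γ i * xi γ i t y) / b = xi γ (1 - i) t y := by
    rw [div_eq_iff hγ']
    linarith [velocity_mul_xi_add hne i t y]
  have hq' : 0 < y - γ i * xi γ i t y ↔ 0 < xi γ (1 - i) t y := by
    rw [← hq, div_pos_iff_of_pos_right hγ]
  have ht' : xi γ (1 - i) t y + xi γ i t y = t := by
    rw [add_comm, xi_add_xi hne]
  rw [hs]
  simp only [hGdef, hq, hq', ht']
  by_cases htA : t ∈ A
  swap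
  · simp [htA]
  simp only [Set.indicator_of_mem htA, Pi.one_apply, mul_one]
  rcases lt_or_gt_of_ne ht with hp | hp
  · rw [exponentialPDF_of_neg hp, 
      if_neg (fun h : 0 < xi γ i t y ∧ 0 < xi γ (1 - i) t y => absurd h.1 hp.not_gt)]
    simp
  · by_cases hq0 : 0 < xi γ (1 - i) t y
    · have := hlam i
      rw [if_pos hq0, if_pos ⟨hp, hq0⟩, exponentialPDF_of_nonneg hp.le,
        ← ENNReal.ofReal_mul (by positivity), ← ENNReal.ofReal_mul (abs_nonneg _)]
      congr 1
      rw [absTheta_eq lam γ i, abs_div, abs_neg, abs_of_pos hγ, hb, abs_velocity_sub,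
        sub_eq_add_neg (-(lam i * xi γ i t y)), Real.exp_add, neg_mul]
      ring
    · rw [if_neg hq0, 
        if_neg (fun h : 0 < xi γ i t y ∧ 0 < xi γ (1 - i) t y => hq0 h.2)]
      simp

/-! ### Densities for velocities of the same sign -/

/-- The density of the passage time with `2 * m + 1` switchings, both velocities positive. -/
noncomputable def oddDensity (lam γ : Fin 2 → ℝ) (m : ℕ) (i : Fin 2) (t y : ℝ) : ℝ :=
  if 0 < xi γ i t y ∧ 0 < xi γ (1 - i) t y then
    lam i * γ (1 - i) * (zfun lam γ t y ^ m / (m.factorial : ℝ) ^ 2) * absTheta lam γ t y else 0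

/-- The density of the passage time with `2 * m + 2` switchings, both velocities positive. -/
noncomputable def evenDensity (lam γ : Fin 2 → ℝ) (m : ℕ) (i : Fin 2) (t y : ℝ) : ℝ :=
  if 0 < xi γ i t y ∧ 0 < xi γ (1 - i) t y then
    lam 0 * lam 1 * γ i * xi γ i t y *
      (zfun lam γ t y ^ m / ((m.factorial : ℝ) * ((m + 1).factorial : ℝ))) * absTheta lam γ t y
  else 0

theorem measurableSet_xi_pos (γ : Fin 2 → ℝ) (i : Fin 2) :
    MeasurableSet {x : ℝ × ℝ | 0 < xi γ i x.1 x.2} :=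
  measurableSet_lt measurable_const (measurable_xi γ i)

theorem measurable_oddDensity (lam γ : Fin 2 → ℝ) (m : ℕ) (i : Fin 2) :
    Measurable (Function.uncurry fun t y => ENNReal.ofReal (oddDensity lam γ m i t y)) := by
  refine Measurable.ennreal_ofReal (Measurable.ite
    ((measurableSet_xi_pos γ i).inter (measurableSet_xi_pos γ (1 - i))) ?_ measurable_const)
  have hz := measurable_zfun lam γ
  have hθ := measurable_absTheta lam γ
  fun_prop

theorem measurable_evenDensity (lam γ : Fin 2 → ℝ) (m : ℕ) (i : Fin 2) :
    Measurable (Function.uncurry fun t y => ENNReal.ofReal (evenDensity lam γ m i t y)) := by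
  refine Measurable.ennreal_ofReal (Measurable.ite
    ((measurableSet_xi_pos γ i).inter (measurableSet_xi_pos γ (1 - i))) ?_ measurable_const)
  have hz := measurable_zfun lam γ
  have hθ := measurable_absTheta lam γ
  have hx := measurable_xi γ i
  fun_prop

theorem hasDerivAt_const_mul_pow_div (c : ℝ) (n : ℕ) (x : ℝ) :
    HasDerivAt (fun x => c * (x ^ (n + 1) / (n + 1))) (c * x ^ n) x := by
  have h : ((n : ℝ) + 1) ≠ 0 := by positivity
  have := ((hasDerivAt_pow (n + 1) x).div_const ((n : ℝ) + 1)).const_mul c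
  simpa [mul_div_cancel_left₀ _ h] using this

section SameSign

variable {lam γ : Fin 2 → ℝ}

theorem pos_of_xi_pos (hγ : ∀ i, 0 < γ i) (hne : γ 0 ≠ γ 1) {i : Fin 2} {t y : ℝ}
    (h : 0 < xi γ i t y ∧ 0 < xi γ (1 - i) t y) : 0 < y := by
  rw [← velocity_mul_xi_add hne i t y]
  exact add_pos (mul_pos (hγ _) h.1) (mul_pos (hγ _) h.2)

theorem oddDensity_step (hlam : ∀ i, 0 < lam i) (hγ : ∀ i, 0 < γ i) (hne : γ 0 ≠ γ 1) (m : ℕ)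
    (i : Fin 2) (t y : ℝ) :
    ∫⁻ s, exponentialPDF (lam i) s *
      ENNReal.ofReal (oddDensity lam γ m (1 - i) (t - s) (y - γ i * s)) =
      ENNReal.ofReal (evenDensity lam γ m i t y) := by
  have hθ := absTheta_pos lam hne t y
  have h0 := hlam i
  have h1 := hlam (1 - i)
  have hgi := hγ i
  set p := xi γ i t y with hp
  set q := xi γ (1 - i) t y with hq
  have hint : ∀ s, oddDensity lam γ m (1 - i) (t - s) (y - γ i * s) =
      if 0 < q ∧ 0 < p - s then lam (1 - i) * γ i *
        ((lam 0 * lam 1 * q) ^ m / (m.factorial : ℝ) ^ 2) * absTheta lam γ t y *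
          (p - s) ^ m * Real.exp (lam i * s) else 0 := fun s => by
    simp only [oddDensity, fin_two_sub_sub, xi_sub_other, xi_sub_self hne, absTheta_sub hne,
      zfun_eq lam γ i (t - s), ← hp, ← hq]
    congr 1
    generalize p - s = x
    ring
  simp only [hint]
  by_cases hq0 : 0 < q
  swap
  · simp only [hq0, false_and, if_false, ENNReal.ofReal_zero, mul_zero, lintegral_zero,
      evenDensity, ← hq, and_false]
  have := rate_mul_rate lam i
  have h01 : 0 < lam 0 * lam 1 := this ▸ mul_pos h0 h1
  set c := lam (1 - i) * γ i * ((lam 0 * lam 1 * q) ^ m / (m.factorial : ℝ) ^ 2) *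
    absTheta lam γ t y with hc
  have hcpos : 0 < c := by positivity
  rw [lintegral_exponentialPDF_mul_of_hasDerivAt (p := p) (ℓ := 0) h0
    (hasDerivAt_const_mul_pow_div c m) (by fun_prop)
    (fun x hx _ => by positivity) (fun s _ => by simp only [hq0, true_and])]
  congr 1
  simp only [evenDensity, ← hp, ← hq, hq0, and_true]
  refine if_congr Iff.rfl ?_ rfl
  have hf : ((m + 1).factorial : ℝ) = (m + 1) * m.factorial := by
    rw [Nat.factorial_succ]; push_cast; ring
  have hm : (m.factorial : ℝ) ≠ 0 := by positivity
  have hm1 : (m : ℝ) + 1 ≠ 0 := by positivity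
  rw [hc, hf, zfun_eq lam γ i, ← hp, ← hq, ← this]
  field_simp
  ring

theorem evenDensity_step (hlam : ∀ i, 0 < lam i) (hγ : ∀ i, 0 < γ i) (hne : γ 0 ≠ γ 1) (m : ℕ)
    (i : Fin 2) (t y : ℝ) :
    ∫⁻ s, exponentialPDF (lam i) s *
      ENNReal.ofReal (evenDensity lam γ m (1 - i) (t - s) (y - γ i * s)) =
      ENNReal.ofReal (oddDensity lam γ (m + 1) i t y) := by
  have hθ := absTheta_pos lam hne t y
  have h0 := hlam i
  have h1 := hlam (1 - i)
  have hgi := hγ (1 - i)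
  set p := xi γ i t y with hp
  set q := xi γ (1 - i) t y with hq
  have hint : ∀ s, evenDensity lam γ m (1 - i) (t - s) (y - γ i * s) =
      if 0 < q ∧ 0 < p - s then lam 0 * lam 1 * γ (1 - i) * q *
        ((lam 0 * lam 1 * q) ^ m / ((m.factorial : ℝ) * ((m + 1).factorial : ℝ))) *
          absTheta lam γ t y * (p - s) ^ m * Real.exp (lam i * s) else 0 := fun s => by
    simp only [evenDensity, fin_two_sub_sub, xi_sub_other, xi_sub_self hne, absTheta_sub hne,
      zfun_eq lam γ i (t - s), ← hp, ← hq]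
    congr 1
    generalize p - s = x
    ring
  simp only [hint]
  by_cases hq0 : 0 < q
  swap
  · simp only [hq0, false_and, if_false, ENNReal.ofReal_zero, mul_zero, lintegral_zero,
      oddDensity, ← hq, and_false]
  have := rate_mul_rate lam i
  have h01 : 0 < lam 0 * lam 1 := this ▸ mul_pos h0 h1
  set c := lam 0 * lam 1 * γ (1 - i) * q * ((lam 0 * lam 1 * q) ^ m /
    ((m.factorial : ℝ) * ((m + 1).factorial : ℝ))) * absTheta lam γ t y with hc
  have hcpos : 0 < c := by positivity
  rw [lintegral_exponentialPDF_mul_of_hasDerivAt (p := p) (ℓ := 0) h0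
    (hasDerivAt_const_mul_pow_div c m) (by fun_prop)
    (fun x hx _ => by positivity) (fun s _ => by simp only [hq0, true_and])]
  congr 1
  simp only [oddDensity, ← hp, ← hq, hq0, and_true]
  refine if_congr Iff.rfl ?_ rfl
  have hf : ((m + 1).factorial : ℝ) = (m + 1) * m.factorial := by
    rw [Nat.factorial_succ]; push_cast; ring
  have hm : (m.factorial : ℝ) ≠ 0 := by positivity
  have hm1 : (m : ℝ) + 1 ≠ 0 := by positivity
  rw [hc, hf, zfun_eq lam γ i, ← hp, ← hq]
  field_simp
  ring

theorem setLIntegral_ofReal_eq_zero {f : ℝ → ℝ} (hf : ∀ t, f t = 0) (A : Set ℝ) :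
    ∫⁻ t in A, ENNReal.ofReal (f t) = 0 := by
  simp [hf]

theorem holdingLaw_passageEvent_even_of_odd (hlam : ∀ i, 0 < lam i) (hγ : ∀ i, 0 < γ i)
    (hne : γ 0 ≠ γ 1) {m : ℕ}
    (hodd : ∀ i y A, MeasurableSet A → holdingLaw lam i (passageEvent γ (2 * m + 1) i y A) =
      ∫⁻ t in A, ENNReal.ofReal (oddDensity lam γ m i t y))
    (i : Fin 2) (y : ℝ) {A : Set ℝ} (hA : MeasurableSet A) :
    holdingLaw lam i (passageEvent γ (2 * m + 2) i y A) =
      ∫⁻ t in A, ENNReal.ofReal (evenDensity lam γ m i t y) := by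
  rcases le_or_gt y 0 with hy | hy
  · rw [passageEvent_of_nonpos γ _ i hy, measure_empty, setLIntegral_ofReal_eq_zero]
    exact fun t => if_neg fun h => hy.not_gt (pos_of_xi_pos hγ hne h)
  · rw [holdingLaw_passageEvent_succ_of_density hlam (measurable_oddDensity lam γ m (1 - i))
      (hodd (1 - i)) hy hA]
    simp only [oddDensity_step hlam hγ hne]

theorem holdingLaw_passageEvent_odd (hlam : ∀ i, 0 < lam i) (hγ : ∀ i, 0 < γ i)
    (hne : γ 0 ≠ γ 1) (m : ℕ) (i : Fin 2) (y : ℝ) {A : Set ℝ} (hA : MeasurableSet A) :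
    holdingLaw lam i (passageEvent γ (2 * m + 1) i y A) =
      ∫⁻ t in A, ENNReal.ofReal (oddDensity lam γ m i t y) := by
  induction m generalizing i y A with
  | zero =>
    rcases le_or_gt y 0 with hy | hy
    · rw [passageEvent_of_nonpos γ _ i hy, measure_empty, setLIntegral_ofReal_eq_zero]
      exact fun t => if_neg fun h => hy.not_gt (pos_of_xi_pos hγ hne h)
    · rw [mul_zero, zero_add, holdingLaw_passageEvent_one hlam hne (hγ _) hy hA]
      simp [oddDensity]
  | succ m ih =>
    rcases le_or_gt y 0 with hy | hy
    · rw [passageEvent_of_nonpos γ _ i hy, measure_empty, setLIntegral_ofReal_eq_zero]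
      exact fun t => if_neg fun h => hy.not_gt (pos_of_xi_pos hγ hne h)
    · rw [show 2 * (m + 1) + 1 = 2 * m + 2 + 1 by ring, holdingLaw_passageEvent_succ_of_density hlam
        (measurable_evenDensity lam γ m (1 - i)) (fun y A hA =>
          holdingLaw_passageEvent_even_of_odd hlam hγ hne (fun i y A hA => ih i y hA) (1 - i) y hA)
        hy hA]
      simp only [evenDensity_step hlam hγ hne]

theorem holdingLaw_passageEvent_even (hlam : ∀ i, 0 < lam i) (hγ : ∀ i, 0 < γ i)
    (hne : γ 0 ≠ γ 1) (m : ℕ) (i : Fin 2) (y : ℝ) {A : Set ℝ} (hA : MeasurableSet A) :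
    holdingLaw lam i (passageEvent γ (2 * m + 2) i y A) =
      ∫⁻ t in A, ENNReal.ofReal (evenDensity lam γ m i t y) :=
  holdingLaw_passageEvent_even_of_odd hlam hγ hne
    (fun i y _ hA => holdingLaw_passageEvent_odd hlam hγ hne m i y hA) i y hA

end SameSign

/-! ### Densities for velocities of opposite signs -/

section OppositeSigns

variable {lam γ : Fin 2 → ℝ}

/-- The density of the passage time through a positive level with `2 * m + 1` switchings from the
state `1`, for `γ 1 < 0 < γ 0`, with the factor `1 / ξ₀` cancelled. For `m = 0` the truncated
exponent `m - 1` is harmless since its coefficient vanishes. -/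
noncomputable def upOddDensity (lam γ : Fin 2 → ℝ) (m : ℕ) (t y : ℝ) : ℝ :=
  if 0 < xi γ 1 t y ∧ 0 < y then
    lam 1 * ((lam 0 * lam 1 * xi γ 1 t y) ^ m / (m.factorial : ℝ) ^ 2) *
      (γ 0 * xi γ 0 t y ^ m +
        γ 1 * xi γ 1 t y * (m / (m + 1)) * xi γ 0 t y ^ (m - 1)) * absTheta lam γ t y
  else 0

/-- The density of the passage time through a positive level with `2 * m + 2` switchings from the
state `0`, for `γ 1 < 0 < γ 0`. -/
noncomputable def upEvenDensity (lam γ : Fin 2 → ℝ) (m : ℕ) (t y : ℝ) : ℝ :=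
  if 0 < xi γ 1 t y ∧ 0 < y then
    lam 0 * lam 1 * y *
      (zfun lam γ t y ^ m / ((m.factorial : ℝ) * ((m + 1).factorial : ℝ))) * absTheta lam γ t y
  else 0

theorem measurable_upOddDensity (lam γ : Fin 2 → ℝ) (m : ℕ) :
    Measurable (Function.uncurry fun t y => ENNReal.ofReal (upOddDensity lam γ m t y)) := by
  refine Measurable.ennreal_ofReal (Measurable.ite
    ((measurableSet_xi_pos γ 1).inter (measurableSet_lt measurable_const measurable_snd)) ?_
    measurable_const)
  have h0 := measurable_xi γ 0
  have h1 := measurable_xi γ 1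
  have hθ := measurable_absTheta lam γ
  fun_prop

theorem measurable_upEvenDensity (lam γ : Fin 2 → ℝ) (m : ℕ) :
    Measurable (Function.uncurry fun t y => ENNReal.ofReal (upEvenDensity lam γ m t y)) := by
  refine Measurable.ennreal_ofReal (Measurable.ite
    ((measurableSet_xi_pos γ 1).inter (measurableSet_lt measurable_const measurable_snd)) ?_
    measurable_const)
  have hz := measurable_zfun lam γ
  have hθ := measurable_absTheta lam γ
  fun_prop

theorem upOddDensity_step (hlam : ∀ i, 0 < lam i) (h0 : 0 < γ 0) (h1 : γ 1 < 0) (m : ℕ)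
    (t y : ℝ) :
    ∫⁻ s, exponentialPDF (lam 0) s * ENNReal.ofReal (upOddDensity lam γ m (t - s) (y - γ 0 * s)) =
      ENNReal.ofReal (upEvenDensity lam γ m t y) := by
  have hne : γ 0 ≠ γ 1 := (h1.trans h0).ne'
  have hθ := absTheta_pos lam hne t y
  have hl0 := hlam 0
  have hl1 := hlam 1
  set p := xi γ 0 t y with hp
  set q := xi γ 1 t y with hq
  have hpq : γ 0 * p + γ 1 * q = y := velocity_mul_xi_add hne 0 t y
  have hp' : ∀ s, xi γ 0 (t - s) (y - γ 0 * s) = p - s := xi_sub_self hne 0 t y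
  have hq' : ∀ s, xi γ 1 (t - s) (y - γ 0 * s) = q := xi_sub_other 0 t y
  -- the value `ℓ` of `ξ₀` at which the path itself reaches the level during the first holding time
  set ℓ := -(γ 1 * q) / γ 0 with hℓ
  have hℓ0 : γ 0 * ℓ + γ 1 * q = 0 := by rw [hℓ, mul_div_cancel₀ _ h0.ne']; ring
  set c := lam 1 * ((lam 0 * lam 1 * q) ^ m / (m.factorial : ℝ) ^ 2) * absTheta lam γ t y with hc
  have hcut : ∀ s, 0 < y - γ 0 * s ↔ ℓ < p - s := fun s => by
    rw [← hpq, hℓ, div_lt_iff₀ h0]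
    constructor <;> intro h <;> linarith
  have hint : ∀ s, upOddDensity lam γ m (t - s) (y - γ 0 * s) =
      if 0 < q ∧ ℓ < p - s then c * (γ 0 * (p - s) ^ m +
        γ 1 * q * (m / (m + 1)) * (p - s) ^ (m - 1)) * Real.exp (lam 0 * s) else 0 := fun s => by
    simp only [upOddDensity, hp', hq', absTheta_sub hne, hcut]
    congr 1
    rw [hc]
    ring
  simp only [hint]
  by_cases hq0 : 0 < q
  swap
  · simp only [hq0, false_and, if_false, ENNReal.ofReal_zero, mul_zero, lintegral_zero,
      upEvenDensity, ← hq]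
  have hcpos : 0 < c := by positivity
  have hℓpos : 0 < ℓ := div_pos (neg_pos.2 (mul_neg_of_neg_of_pos h1 hq0)) h0
  have hm1 : (m : ℝ) + 1 ≠ 0 := by positivity
  have hH : ∀ x, HasDerivAt (fun x => c * (x ^ m / (m + 1) * (γ 0 * x + γ 1 * q)))
      (c * (γ 0 * x ^ m + γ 1 * q * (m / (m + 1)) * x ^ (m - 1))) x := fun x => by
    have := (((hasDerivAt_pow m x).div_const ((m : ℝ) + 1)).fun_mul
      (((hasDerivAt_id x).const_mul (γ 0)).add_const (γ 1 * q))).const_mul c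
    refine this.congr_deriv ?_
    have hxm : (m : ℝ) * x ^ (m - 1) * x = m * x ^ m := by
      cases m with
      | zero => simp
      | succ k => simp only [Nat.add_sub_cancel]; ring
    simp only [id]
    field_simp
    linear_combination (γ 0) * hxm
  rw [lintegral_exponentialPDF_mul_of_hasDerivAt (p := p) (ℓ := ℓ) hl0 hH (by fun_prop) ?_
    (fun s _ => by simp only [hq0, true_and])]
  · congr 1
    have hpy : ℓ < p ↔ 0 < y := by simpa using (hcut 0).symm
    simp only [upEvenDensity, ← hq, hq0, true_and, hpy, hℓ0, hpq]
    refine if_congr Iff.rfl ?_ rfl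
    have hf : ((m + 1).factorial : ℝ) = (m + 1) * m.factorial := by
      rw [Nat.factorial_succ]; push_cast; ring
    have hm : (m.factorial : ℝ) ≠ 0 := by positivity
    rw [hc, hf, show zfun lam γ t y = lam 0 * lam 1 * p * q from rfl]
    field_simp
    ring
  · intro x hx _
    have hx0 : 0 < x := hℓpos.trans hx
    have h2 : 0 < γ 0 * x + γ 1 * q := by nlinarith
    refine mul_nonneg hcpos.le ?_
    cases m with
    | zero => simp [h0.le]
    | succ k =>
      have h3 : ((k + 1 : ℕ) : ℝ) / ((k + 1 : ℕ) + 1) ≤ 1 := by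
        rw [div_le_one (by positivity)]; linarith
      have h4 : γ 1 * q ≤ γ 1 * q * (((k + 1 : ℕ) : ℝ) / ((k + 1 : ℕ) + 1)) := by
        nlinarith [mul_neg_of_neg_of_pos h1 hq0]
      have h5 : γ 0 * x ^ (k + 1) + γ 1 * q * (((k + 1 : ℕ) : ℝ) / ((k + 1 : ℕ) + 1)) *
          x ^ (k + 1 - 1) =
          (γ 0 * x + γ 1 * q * (((k + 1 : ℕ) : ℝ) / ((k + 1 : ℕ) + 1))) * x ^ k := by
        simp only [Nat.add_sub_cancel]; ring
      rw [h5]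
      exact mul_nonneg (by linarith) (by positivity)

theorem upEvenDensity_step (hlam : ∀ i, 0 < lam i) (h0 : 0 < γ 0) (h1 : γ 1 < 0) (m : ℕ)
    (t : ℝ) {y : ℝ} (hy : 0 < y) :
    ∫⁻ s, exponentialPDF (lam 1) s * ENNReal.ofReal (upEvenDensity lam γ m (t - s) (y - γ 1 * s)) =
      ENNReal.ofReal (upOddDensity lam γ (m + 1) t y) := by
  have hne : γ 0 ≠ γ 1 := (h1.trans h0).ne'
  have hθ := absTheta_pos lam hne t y
  have hl0 := hlam 0
  have hl1 := hlam 1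
  set p := xi γ 0 t y with hp
  set q := xi γ 1 t y with hq
  have hpq : γ 0 * p + γ 1 * q = y := velocity_mul_xi_add hne 0 t y
  have hp' : ∀ s, xi γ 0 (t - s) (y - γ 1 * s) = p := xi_sub_other 1 t y
  have hq' : ∀ s, xi γ 1 (t - s) (y - γ 1 * s) = q - s := xi_sub_self hne 1 t y
  set c := lam 0 * lam 1 * ((lam 0 * lam 1 * p) ^ m /
    ((m.factorial : ℝ) * ((m + 1).factorial : ℝ))) * absTheta lam γ t y with hc
  have hint : ∀ s, 0 ≤ s → upEvenDensity lam γ m (t - s) (y - γ 1 * s) =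
      if 0 < q - s then (c * γ 0 * p * (q - s) ^ m + c * γ 1 * (q - s) ^ (m + 1)) *
        Real.exp (lam 1 * s) else 0 := fun s hs => by
    have hys : 0 < y - γ 1 * s := by nlinarith
    simp only [upEvenDensity, hq', absTheta_sub hne, hys, and_true, zfun, hp']
    congr 1
    rw [hc, show y - γ 1 * s = γ 0 * p + γ 1 * (q - s) by linarith]
    generalize q - s = x
    ring
  rw [lintegral_exponentialPDF_mul_of_hasDerivAt (p := q) (ℓ := 0) hl1
    (fun x => (hasDerivAt_const_mul_pow_div (c * γ 0 * p) m x).fun_add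
      (hasDerivAt_const_mul_pow_div (c * γ 1) (m + 1) x)) (by fun_prop) ?_
    (fun s hs => by rw [hint s hs])]
  · congr 1
    simp only [upOddDensity, ← hp, ← hq, hy, and_true]
    refine if_congr Iff.rfl ?_ rfl
    have hf : ((m + 1).factorial : ℝ) = (m + 1) * m.factorial := by
      rw [Nat.factorial_succ]; push_cast; ring
    have hm : (m.factorial : ℝ) ≠ 0 := by positivity
    have hm1 : (m : ℝ) + 1 ≠ 0 := by positivity
    have hm2 : (m : ℝ) + 1 + 1 ≠ 0 := by positivity
    rw [hc, hf, Nat.add_sub_cancel]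
    push_cast
    field_simp
    ring
  · intro x hx hxq
    have hq0 : 0 < q := hx.trans_le hxq
    have hpx : 0 ≤ γ 0 * p + γ 1 * x := by nlinarith
    have hp0 : 0 < p := by
      by_contra h
      nlinarith [not_lt.1 h]
    have : c * γ 0 * p * x ^ m + c * γ 1 * x ^ (m + 1) = c * (γ 0 * p + γ 1 * x) * x ^ m := by ring
    rw [this]
    positivity

theorem holdingLaw_passageEvent_up_even_of_odd (hlam : ∀ i, 0 < lam i) (h0 : 0 < γ 0)
    (h1 : γ 1 < 0) {m : ℕ}
    (hodd : ∀ y A, MeasurableSet A → holdingLaw lam 1 (passageEvent γ (2 * m + 1) 1 y A) =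
      ∫⁻ t in A, ENNReal.ofReal (upOddDensity lam γ m t y))
    (y : ℝ) {A : Set ℝ} (hA : MeasurableSet A) :
    holdingLaw lam 0 (passageEvent γ (2 * m + 2) 0 y A) =
      ∫⁻ t in A, ENNReal.ofReal (upEvenDensity lam γ m t y) := by
  rcases le_or_gt y 0 with hy | hy
  · rw [passageEvent_of_nonpos γ _ 0 hy, measure_empty, setLIntegral_ofReal_eq_zero]
    exact fun t => if_neg fun h => hy.not_gt h.2
  · rw [holdingLaw_passageEvent_succ_of_density hlam (i := 0) (measurable_upOddDensity lam γ m)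
      hodd hy hA]
    simp only [upOddDensity_step hlam h0 h1 m]

theorem holdingLaw_passageEvent_up_odd (hlam : ∀ i, 0 < lam i) (h0 : 0 < γ 0)
    (h1 : γ 1 < 0) (m : ℕ) (y : ℝ) {A : Set ℝ} (hA : MeasurableSet A) :
    holdingLaw lam 1 (passageEvent γ (2 * m + 1) 1 y A) =
      ∫⁻ t in A, ENNReal.ofReal (upOddDensity lam γ m t y) := by
  have hne : γ 0 ≠ γ 1 := (h1.trans h0).ne'
  induction m generalizing y A with
  | zero =>
    rcases le_or_gt y 0 with hy | hy
    · rw [passageEvent_of_nonpos γ _ 1 hy, measure_empty, setLIntegral_ofReal_eq_zero]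
      exact fun t => if_neg fun h => hy.not_gt h.2
    · rw [mul_zero, zero_add, holdingLaw_passageEvent_one hlam hne (i := 1) h0 hy hA]
      refine lintegral_congr fun t => ?_
      have hpq : γ 0 * xi γ 0 t y + γ 1 * xi γ 1 t y = y := velocity_mul_xi_add hne 0 t y
      have hiff : (0 < xi γ 1 t y ∧ 0 < xi γ (1 - 1) t y) ↔ (0 < xi γ 1 t y ∧ 0 < y) := by
        refine and_congr_right fun hq => ⟨fun _ => hy, fun _ => ?_⟩
        change 0 < xi γ 0 t y
        by_contra h
        nlinarith [not_lt.1 h]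
      simp only [upOddDensity, hiff]
      simp
  | succ m ih =>
    rcases le_or_gt y 0 with hy | hy
    · rw [passageEvent_of_nonpos γ _ 1 hy, measure_empty, setLIntegral_ofReal_eq_zero]
      exact fun t => if_neg fun h => hy.not_gt h.2
    · rw [show 2 * (m + 1) + 1 = 2 * m + 2 + 1 by ring, holdingLaw_passageEvent_succ_of_density hlam
        (i := 1) (measurable_upEvenDensity lam γ m) (fun y A hA =>
          holdingLaw_passageEvent_up_even_of_odd hlam h0 h1 (fun y A hA => ih y hA) y hA)
        hy hA]
      simp only [upEvenDensity_step hlam h0 h1 m _ hy]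

theorem holdingLaw_passageEvent_up_even (hlam : ∀ i, 0 < lam i) (h0 : 0 < γ 0)
    (h1 : γ 1 < 0) (m : ℕ) (y : ℝ) {A : Set ℝ} (hA : MeasurableSet A) :
    holdingLaw lam 0 (passageEvent γ (2 * m + 2) 0 y A) =
      ∫⁻ t in A, ENNReal.ofReal (upEvenDensity lam γ m t y) :=
  holdingLaw_passageEvent_up_even_of_odd hlam h0 h1
    (fun y _ hA => holdingLaw_passageEvent_up_odd hlam h0 h1 m y hA) y hA

end OppositeSigns

/-! ### Paths of the telegraph process -/

section Paths

variable {Ω : Type*}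

/-- The regularity of a single path that holds almost surely: it starts in the state `i` at the
time `0`, its switching times increase strictly, and its state is given by their number. -/
structure IsRegularPath (ε : ℝ → Ω → Fin 2) (τ : ℕ → Ω → ℝ) (i : Fin 2) (ω : Ω) : Prop where
  time_zero : τ 0 ω = 0
  gap_pos : ∀ n, 0 < τ (n + 1) ω - τ n ω
  state_eq : ∀ (n : ℕ) (t : ℝ), τ n ω ≤ t → t < τ (n + 1) ω → ε t ω = stateAfter i n

/-- The sequence of holding times of the path `ω`. -/
def gaps (τ : ℕ → Ω → ℝ) (ω : Ω) (n : ℕ) : ℝ := τ (n + 1) ω - τ n ω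

namespace IsRegularPath

variable {ε : ℝ → Ω → Fin 2} {τ : ℕ → Ω → ℝ} {i : Fin 2} {ω : Ω}

theorem strictMono (h : IsRegularPath ε τ i ω) : StrictMono fun n => τ n ω :=
  strictMono_nat_of_lt_succ fun n => sub_pos.1 (h.gap_pos n)

theorem time_nonneg (h : IsRegularPath ε τ i ω) (n : ℕ) : 0 ≤ τ n ω :=
  h.time_zero ▸ h.strictMono.monotone n.zero_le

theorem sum_gaps (h : IsRegularPath ε τ i ω) (n : ℕ) :
    ∑ k ∈ Finset.range n, gaps τ ω k = τ n ω := by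
  simp only [gaps, Finset.sum_range_sub (fun n => τ n ω), h.time_zero, sub_zero]

theorem exists_mem_Ico (h : IsRegularPath ε τ i ω) {t : ℝ} (ht : 0 ≤ t) {n : ℕ}
    (hn : t < τ n ω) : ∃ k < n, τ k ω ≤ t ∧ t < τ (k + 1) ω := by
  induction n with
  | zero => exact absurd (h.time_zero ▸ hn) ht.not_gt
  | succ n ih =>
    rcases lt_or_ge t (τ n ω) with h' | h'
    · obtain ⟨k, hk, hkt⟩ := ih h'
      exact ⟨k, by omega, hkt⟩
    · exact ⟨n, by omega, h', hn⟩

theorem integral_piece (h : IsRegularPath ε τ i ω) (γ : Fin 2 → ℝ) {n : ℕ} {t : ℝ}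
    (h1 : τ n ω ≤ t) (h2 : t ≤ τ (n + 1) ω) :
    IntervalIntegrable (fun s => γ (ε s ω)) volume (τ n ω) t ∧
      ∫ s in (τ n ω)..t, γ (ε s ω) = γ (stateAfter i n) * (t - τ n ω) := by
  have heq : ∀ s ∈ Set.Ioo (τ n ω) t, γ (stateAfter i n) = γ (ε s ω) := fun s hs => by
    rw [h.state_eq n s hs.1.le (hs.2.trans_le h2)]
  constructor
  · rw [intervalIntegrable_iff_integrableOn_Ioo_of_le h1]
    refine IntegrableOn.congr_fun ?_ heq measurableSet_Ioo
    exact integrableOn_const (by simp)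
  · rw [intervalIntegral.integral_of_le h1, integral_Ioc_eq_integral_Ioo,
      ← setIntegral_congr_fun measurableSet_Ioo heq, setIntegral_const]
    simp [Real.volume_real_Ioo_of_le h1, mul_comm]

theorem integral_time (h : IsRegularPath ε τ i ω) (γ : Fin 2 → ℝ) (n : ℕ) :
    IntervalIntegrable (fun s => γ (ε s ω)) volume 0 (τ n ω) ∧
      ∫ s in (0 : ℝ)..(τ n ω), γ (ε s ω) = pathSum γ i (gaps τ ω) n := by
  induction n with
  | zero => simp [h.time_zero, pathSum_zero]
  | succ n ih =>
    have hp := h.integral_piece γ (sub_pos.1 (h.gap_pos n)).le le_rfl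
    refine ⟨ih.1.trans hp.1, ?_⟩
    rw [← intervalIntegral.integral_add_adjacent_intervals ih.1 hp.1, ih.2, hp.2, pathSum_succ]
    rfl

/-- On each holding interval the telegraph process is affine. -/
theorem telegraph_eq (h : IsRegularPath ε τ i ω) (γ : Fin 2 → ℝ) {n : ℕ} {t : ℝ}
    (h1 : τ n ω ≤ t) (h2 : t ≤ τ (n + 1) ω) :
    telegraph γ ε t ω = pathSum γ i (gaps τ ω) n + γ (stateAfter i n) * (t - τ n ω) := by
  have h3 := h.integral_time γ n
  have hp := h.integral_piece γ h1 h2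
  rw [telegraph, ← intervalIntegral.integral_add_adjacent_intervals h3.1 hp.1, h3.2, hp.2]

theorem switchCount_eq (h : IsRegularPath ε τ i ω) {t : ℝ} {n : ℕ} (h1 : τ n ω ≤ t)
    (h2 : t < τ (n + 1) ω) : switchCount τ t ω = n := by
  have : {k : ℕ | τ (k + 1) ω ≤ t} = (Finset.range n : Set ℕ) := by
    ext k
    simp only [Set.mem_ofPred_eq, Finset.coe_range, Set.mem_Iio]
    constructor
    · intro hk
      have := h.strictMono.lt_iff_lt.1 (hk.trans_lt h2)
      omega
    · exact fun hk => (h.strictMono.monotone (Nat.succ_le_of_lt hk)).trans h1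
  rw [switchCount, this, Set.encard_coe_eq_coe_finsetCard, Finset.card_range]

theorem mem_Ico_of_switchCount_eq (h : IsRegularPath ε τ i ω) {t : ℝ} (ht : 0 ≤ t) {n : ℕ}
    (hn : switchCount τ t ω = n) : τ n ω ≤ t ∧ t < τ (n + 1) ω := by
  by_cases hall : ∀ k, τ (k + 1) ω ≤ t
  · have : {k : ℕ | τ (k + 1) ω ≤ t} = Set.univ := Set.eq_univ_of_forall hall
    rw [switchCount, this, Set.infinite_univ.encard_eq] at hn
    exact absurd hn.symm (ENat.natCast_ne_top n)
  · push Not at hall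
    obtain ⟨k, hk⟩ := hall
    obtain ⟨m, -, hm1, hm2⟩ := h.exists_mem_Ico ht hk
    rw [h.switchCount_eq hm1 hm2, Nat.cast_inj] at hn
    exact hn ▸ ⟨hm1, hm2⟩

/-- If the level lies above the first `n` turning points and below the next one, it is reached for
the first time after exactly `n` switchings. -/
theorem exists_of_mem_passageEvent (h : IsRegularPath ε τ i ω) {γ : Fin 2 → ℝ} {y : ℝ} {A : Set ℝ}
    {n : ℕ} (hE : gaps τ ω ∈ passageEvent γ n i y A) :
    ∃ t ∈ A, 0 < t ∧ telegraph γ ε t ω = y ∧ firstPassage γ ε y ω = (t : EReal) ∧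
      switchCount τ t ω = (n : ℕ∞) := by
  set S := pathSum γ i (gaps τ ω) with hS
  have hSs : ∀ k, S (k + 1) = S k + γ (stateAfter i k) * (τ (k + 1) ω - τ k ω) :=
    fun k => pathSum_succ _ _ _ _
  simp only [passageEvent, Set.mem_ofPred_eq, h.sum_gaps, ← hS] at hE
  obtain ⟨hbelow, habove, hA⟩ := hE
  have hn := hbelow n le_rfl
  have hd := h.gap_pos n
  rw [hSs] at habove
  have hγn : 0 < γ (stateAfter i n) := by
    by_contra hneg
    nlinarith [not_lt.1 hneg]
  set t := τ n ω + (y - S n) / γ (stateAfter i n) with ht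
  have ht1 : τ n ω < t := by
    have : 0 < (y - S n) / γ (stateAfter i n) := div_pos (by linarith) hγn
    linarith
  have ht2 : t < τ (n + 1) ω := by
    have : (y - S n) / γ (stateAfter i n) < τ (n + 1) ω - τ n ω := by
      rw [div_lt_iff₀' hγn]; linarith
    linarith
  have hty : telegraph γ ε t ω = y := by
    rw [h.telegraph_eq γ ht1.le ht2.le, ← hS, ht, add_sub_cancel_left,
      mul_div_cancel₀ _ hγn.ne']
    ring
  have ht0 : 0 < t := (h.time_nonneg n).trans_lt ht1
  refine ⟨t, hA, ht0, hty, IsLeast.csInf_eq ⟨⟨t, ⟨ht0, hty⟩, rfl⟩, ?_⟩, h.switchCount_eq ht1.le ht2⟩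
  rintro _ ⟨s, ⟨hs0, hsy⟩, rfl⟩
  refine EReal.coe_le_coe_iff.2 (not_lt.1 fun hst => ?_)
  obtain ⟨k, hk, hk1, hk2⟩ := h.exists_mem_Ico hs0.le (hst.trans ht2)
  have hlin := h.telegraph_eq γ hk1 hk2.le
  rw [hsy, ← hS] at hlin
  rcases Nat.lt_succ_iff_lt_or_eq.1 hk with hkn | rfl
  · have hk3 := hbelow k hkn.le
    have hk4 := hbelow (k + 1) hkn
    rw [hSs] at hk4
    rcases le_or_gt 0 (γ (stateAfter i k)) with hs | hs <;> nlinarith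
  · have h5 := h.telegraph_eq γ ht1.le ht2.le
    rw [hty, ← hS] at h5
    nlinarith

/-- Away from turning points, the first passage with `n` switchings happens in `A` exactly when the
holding times lie in `passageEvent`. -/
theorem mem_passageInWith_iff (h : IsRegularPath ε τ i ω) {γ : Fin 2 → ℝ} (hγ : ∀ j, γ j ≠ 0)
    {y : ℝ} (hy : 0 < y) (hturn : ∀ n, pathSum γ i (gaps τ ω) (n + 1) ≠ y) (A : Set ℝ) (n : ℕ) :
    ω ∈ passageInWith γ ε τ y A n ↔ gaps τ ω ∈ passageEvent γ n i y A := by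
  set S := pathSum γ i (gaps τ ω) with hS
  have hS0 : S 0 = 0 := pathSum_zero _ _ _
  have hSs : ∀ k, S (k + 1) = S k + γ (stateAfter i k) * (τ (k + 1) ω - τ k ω) :=
    fun k => pathSum_succ _ _ _ _
  have hne : ∀ k, S k ≠ y := fun k => by
    cases k with
    | zero => rw [hS0]; exact hy.ne
    | succ k => exact hturn k
  simp only [passageInWith, passageEvent, Set.mem_ofPred_eq, h.sum_gaps, ← hS]
  constructor
  · rintro ⟨t, htA, hT, hN⟩
    have hlow : ∀ s, 0 < s → telegraph γ ε s ω = y → t ≤ s := fun s hs hsy => by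
      rw [← EReal.coe_le_coe_iff, ← hT]
      exact sInf_le ⟨s, ⟨hs, hsy⟩, rfl⟩
    have happrox : ∀ u : ℝ, t < u → ∃ s, 0 < s ∧ telegraph γ ε s ω = y ∧ s < u := fun u hu => by
      rw [← EReal.coe_lt_coe_iff, ← hT, firstPassage, sInf_lt_iff] at hu
      obtain ⟨_, ⟨s, hs, rfl⟩, hsu⟩ := hu
      exact ⟨s, hs.1, hs.2, EReal.coe_lt_coe_iff.1 hsu⟩
    have ht0 : 0 ≤ t := by
      rw [← EReal.coe_le_coe_iff, ← hT]
      refine le_sInf ?_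
      rintro _ ⟨s, hs, rfl⟩
      exact EReal.coe_le_coe_iff.2 hs.1.le
    obtain ⟨ht1, ht2⟩ := h.mem_Ico_of_switchCount_eq ht0 hN
    -- the infimum is attained, since the path is affine and not constant just after `t`
    obtain ⟨s, hs0, hsy, hs2⟩ := happrox _ ht2
    have hts := hlow s hs0 hsy
    have hform : ∀ s, 0 < s → telegraph γ ε s ω = y → s < τ (n + 1) ω →
        s = τ n ω + (y - S n) / γ (stateAfter i n) := fun s hs0 hsy hs2 => by
      have := h.telegraph_eq γ (ht1.trans (hlow s hs0 hsy)) hs2.le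
      rw [hsy, ← hS] at this
      rw [this, add_sub_cancel_left, mul_div_cancel_left₀ _ (hγ _)]
      ring
    have hst : s = t := by
      refine le_antisymm (not_lt.1 fun hlt => ?_) hts
      obtain ⟨u, hu0, huy, hus⟩ := happrox s hlt
      have := (hform u hu0 huy (hus.trans hs2)).trans (hform s hs0 hsy hs2).symm
      linarith
    subst hst
    have hbelow : ∀ k ≤ n, S k < y := by
      intro k
      induction k with
      | zero => exact fun _ => hS0 ▸ hy
      | succ k ih =>
        intro hk
        have hk' := ih (by omega)
        refine lt_of_le_of_ne (not_lt.1 fun hlt => ?_) (hne _)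
        -- otherwise the level is crossed during the `k`-th holding time
        have hd := h.gap_pos k
        have hSk := hSs k
        have hγk : 0 < γ (stateAfter i k) := by
          by_contra hneg
          nlinarith [not_lt.1 hneg]
        set u := τ k ω + (y - S k) / γ (stateAfter i k) with hu
        have hu1 : τ k ω < u := by
          have : 0 < (y - S k) / γ (stateAfter i k) := div_pos (by linarith) hγk
          linarith
        have hu2 : u < τ (k + 1) ω := by
          have : (y - S k) / γ (stateAfter i k) < τ (k + 1) ω - τ k ω := by
            rw [div_lt_iff₀' hγk]; linarith
          linarith
        have huy : telegraph γ ε u ω = y := by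
          rw [h.telegraph_eq γ hu1.le hu2.le, ← hS, hu, add_sub_cancel_left,
            mul_div_cancel₀ _ hγk.ne']
          ring
        have := hlow u ((h.time_nonneg k).trans_lt hu1) huy
        have h3 : τ (k + 1) ω ≤ τ n ω := h.strictMono.monotone hk
        linarith
    have hsf := hform s hs0 hsy hs2
    refine ⟨hbelow, ?_, hsf ▸ htA⟩
    have hn := hbelow n le_rfl
    have hlin := h.telegraph_eq γ ht1 hs2.le
    rw [hsy, ← hS] at hlin
    have hγn : 0 < γ (stateAfter i n) := by
      by_contra hneg
      nlinarith [not_lt.1 hneg]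
    rw [hSs]
    nlinarith
  · intro hE
    obtain ⟨t, htA, -, -, ht, hN⟩ := h.exists_of_mem_passageEvent (γ := γ) (y := y) (A := A) (n := n)
      (by simpa only [passageEvent, Set.mem_ofPred_eq, h.sum_gaps] using hE)
    exact ⟨t, htA, ht, hN⟩

theorem mul_le_telegraph (h : IsRegularPath ε τ i ω) {γ : Fin 2 → ℝ} {m : ℝ}
    (hm : ∀ j, m ≤ γ j) (hτ : Filter.Tendsto (fun n => τ n ω) Filter.atTop Filter.atTop) {t : ℝ}
    (ht : 0 ≤ t) : m * t ≤ telegraph γ ε t ω := by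
  obtain ⟨n, hn⟩ := (hτ.eventually_gt_atTop t).exists
  obtain ⟨k, -, hk1, hk2⟩ := h.exists_mem_Ico ht hn
  have hsum : m * τ k ω ≤ pathSum γ i (gaps τ ω) k := by
    rw [← h.sum_gaps, Finset.mul_sum, pathSum]
    exact Finset.sum_le_sum fun j _ => mul_le_mul_of_nonneg_right (hm _) (h.gap_pos j).le
  rw [h.telegraph_eq γ hk1 hk2.le]
  nlinarith [hm (stateAfter i k)]

theorem exists_mem_passageEvent (h : IsRegularPath ε τ i ω) {γ : Fin 2 → ℝ} (hγ : ∀ j, 0 < γ j)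
    (hτ : Filter.Tendsto (fun n => τ n ω) Filter.atTop Filter.atTop)
    {y : ℝ} (hy : 0 < y) (hturn : ∀ n, pathSum γ i (gaps τ ω) (n + 1) ≠ y) :
    ∃ n, gaps τ ω ∈ passageEvent γ n i y Set.univ := by
  classical
  set m := min (γ 0) (γ 1)
  have hm0 : 0 < m := lt_min (hγ 0) (hγ 1)
  have hm : ∀ j, m ≤ γ j := fun j => by
    fin_cases j
    · exact min_le_left _ _
    · exact min_le_right _ _
  have hex : ∃ n, y < pathSum γ i (gaps τ ω) n := by
    obtain ⟨n, hn⟩ := (hτ.eventually_gt_atTop (y / m)).exists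
    refine ⟨n, ((div_lt_iff₀' hm0).1 hn).trans_le ?_⟩
    rw [← h.sum_gaps, Finset.mul_sum, pathSum]
    exact Finset.sum_le_sum fun j _ => mul_le_mul_of_nonneg_right (hm _) (h.gap_pos j).le
  have hfind := Nat.find_spec hex
  have hmin : ∀ k < Nat.find hex, pathSum γ i (gaps τ ω) k < y := fun k hk => by
    refine lt_of_le_of_ne (not_lt.1 (Nat.find_min hex hk)) ?_
    cases k with
    | zero => rw [pathSum_zero]; exact hy.ne
    | succ k => exact hturn k
  obtain ⟨n, hn⟩ : ∃ n, Nat.find hex = n + 1 := by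
    refine Nat.exists_eq_succ_of_ne_zero fun h0 => ?_
    rw [h0, pathSum_zero] at hfind
    exact hy.not_gt hfind
  rw [hn] at hfind hmin
  exact ⟨n, fun k hk => hmin k (by omega), hfind, Set.mem_univ _⟩

end IsRegularPath

theorem telegraph_neg (γ : Fin 2 → ℝ) (ε : ℝ → Ω → Fin 2) (t : ℝ) (ω : Ω) :
    telegraph (-γ) ε t ω = -telegraph γ ε t ω :=
  intervalIntegral.integral_neg

theorem firstPassage_neg (γ : Fin 2 → ℝ) (ε : ℝ → Ω → Fin 2) (y : ℝ) :
    firstPassage (-γ) ε (-y) = firstPassage γ ε y := by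
  funext ω
  simp only [firstPassage, telegraph_neg, neg_inj]

theorem passageIn_neg (γ : Fin 2 → ℝ) (ε : ℝ → Ω → Fin 2) (y : ℝ) :
    passageIn (-γ) ε (-y) = passageIn γ ε y := by
  funext A
  simp only [passageIn, firstPassage_neg]

theorem passageInWith_neg (γ : Fin 2 → ℝ) (ε : ℝ → Ω → Fin 2) (τ : ℕ → Ω → ℝ) (y : ℝ) :
    passageInWith (-γ) ε τ (-y) = passageInWith γ ε τ y := by
  funext A n
  simp only [passageInWith, firstPassage_neg]

end Paths

/-! ### The law of the first passage under `P_i` -/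

section ProcessLaw

variable {Ω : Type*} [MeasurableSpace Ω] {P : Measure Ω}
  {lam : Fin 2 → ℝ} {ε : ℝ → Ω → Fin 2} {τ : ℕ → Ω → ℝ}

theorem measurableSet_start (hε : IsSwitchingProcess P lam ε τ) (i : Fin 2) :
    MeasurableSet {ω | ε 0 ω = i} :=
  hε.measurable_state 0 le_rfl (measurableSet_singleton i)

theorem ae_of_forall_condStart [IsProbabilityMeasure P] (hε : IsSwitchingProcess P lam ε τ)
    {p : Ω → Prop}
    (h : ∀ i, P {ω | ε 0 ω = i} ≠ 0 → ∀ᵐ ω ∂condStart P ε i, p ω) : ∀ᵐ ω ∂P, p ω := by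
  have key : ∀ i, ∀ᵐ ω ∂P, ε 0 ω = i → p ω := fun i => by
    by_cases hi : P {ω | ε 0 ω = i} = 0
    · filter_upwards [measure_eq_zero_iff_ae_notMem.1 hi] with ω hω h'
      exact absurd h' hω
    · have := h i hi
      rw [condStart, ProbabilityTheory.cond, Measure.ae_ennreal_smul_measure_iff
        (ENNReal.inv_ne_zero.2 (measure_ne_top _ _))] at this
      exact (ae_restrict_iff' (measurableSet_start hε i)).1 this
  filter_upwards [ae_all_iff.2 key] with ω hω
  exact hω _ rfl

theorem measurable_gaps (hε : IsSwitchingProcess P lam ε τ) : Measurable (gaps τ) :=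
  measurable_pi_lambda _ fun n => (hε.measurable_time (n + 1)).sub (hε.measurable_time n)

theorem map_gaps (hε : IsSwitchingProcess P lam ε τ) {i : Fin 2} (hi : P {ω | ε 0 ω = i} ≠ 0) :
    (condStart P ε i).map (gaps τ) = holdingLaw lam i := by
  have := (hε.indep i hi).map_fun_eq_infinitePi_map
    (fun n => (hε.measurable_time (n + 1)).sub (hε.measurable_time n))
  refine this.trans ?_
  rw [holdingLaw]
  congr 1
  funext n
  exact hε.law i hi n

theorem ae_gaps (hε : IsSwitchingProcess P lam ε τ) {i : Fin 2} (hi : P {ω | ε 0 ω = i} ≠ 0)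
    {p : (ℕ → ℝ) → Prop} (h : ∀ᵐ d ∂holdingLaw lam i, p d) :
    ∀ᵐ ω ∂condStart P ε i, p (gaps τ ω) := by
  rw [← map_gaps hε hi] at h
  exact ae_of_ae_map (measurable_gaps hε).aemeasurable h

theorem ae_condStart_isRegularPath (hlam : ∀ i, 0 < lam i) (hε : IsSwitchingProcess P lam ε τ)
    {i : Fin 2} (hi : P {ω | ε 0 ω = i} ≠ 0) :
    ∀ᵐ ω ∂condStart P ε i, IsRegularPath ε τ i ω := by
  have hac : condStart P ε i ≪ P := cond_absolutelyContinuous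
  filter_upwards [hac.ae_le hε.time_zero, hac.ae_le hε.state_eq,
    ae_cond_mem (measurableSet_start hε i), ae_gaps hε hi (ae_holdingLaw_pos hlam i)]
    with ω h0 hst hstart hpos
  exact ⟨h0, hpos, fun n t h1 h2 => by rw [hst n t h1 h2]; exact congrArg (stateAfter · n) hstart⟩

theorem ae_condStart_tendsto (hlam : ∀ i, 0 < lam i) (hε : IsSwitchingProcess P lam ε τ)
    {i : Fin 2} (hi : P {ω | ε 0 ω = i} ≠ 0) :
    ∀ᵐ ω ∂condStart P ε i, Filter.Tendsto (fun n => τ n ω) Filter.atTop Filter.atTop := by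
  filter_upwards [ae_condStart_isRegularPath hlam hε hi,
    ae_gaps hε hi (ae_holdingLaw_tendsto hlam i)] with ω hω h
  simpa only [hω.sum_gaps] using h

theorem passageInWith_ae_iff (hlam : ∀ i, 0 < lam i) (hε : IsSwitchingProcess P lam ε τ)
    {γ : Fin 2 → ℝ} (hγ : ∀ j, γ j ≠ 0) {y : ℝ} (hy : 0 < y) {i : Fin 2}
    (hi : P {ω | ε 0 ω = i} ≠ 0) : ∀ᵐ ω ∂condStart P ε i, ∀ (A : Set ℝ) (n : ℕ),
      ω ∈ passageInWith γ ε τ y A n ↔ gaps τ ω ∈ passageEvent γ n i y A := by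
  filter_upwards [ae_condStart_isRegularPath hlam hε hi,
    ae_gaps hε hi (ae_holdingLaw_pathSum_ne hlam hγ i y)] with ω hω h A n
  exact hω.mem_passageInWith_iff hγ hy h A n

theorem condStart_passageInWith (hlam : ∀ i, 0 < lam i) (hε : IsSwitchingProcess P lam ε τ)
    {γ : Fin 2 → ℝ} (hγ : ∀ j, γ j ≠ 0) {y : ℝ} (hy : 0 < y) {i : Fin 2}
    (hi : P {ω | ε 0 ω = i} ≠ 0) {A : Set ℝ} (hA : MeasurableSet A) (n : ℕ) :
    condStart P ε i (passageInWith γ ε τ y A n) =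
      holdingLaw lam i (passageEvent γ n i y A) := by
  rw [← map_gaps hε hi, Measure.map_apply (measurable_gaps hε)
    (measurableSet_passageEvent γ n i y hA)]
  refine measure_congr (Filter.eventuallyEq_set.2 ?_)
  filter_upwards [passageInWith_ae_iff hlam hε hγ hy hi] with ω h
  exact h A n

/-- Velocities of one sign and a level of the other sign: the process never gets there. -/
theorem ae_firstPassage_eq_top [IsProbabilityMeasure P] (hlam : ∀ i, 0 < lam i)
    (hε : IsSwitchingProcess P lam ε τ) {γ : Fin 2 → ℝ} (hγ : ∀ j, 0 < γ j) {y : ℝ} (hy : y < 0) :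
    ∀ᵐ ω ∂P, firstPassage γ ε y ω = ⊤ := by
  refine ae_of_forall_condStart hε fun i hi => ?_
  filter_upwards [ae_condStart_isRegularPath hlam hε hi, ae_condStart_tendsto hlam hε hi]
    with ω hω hτ
  have : {t : ℝ | 0 < t ∧ telegraph γ ε t ω = y} = ∅ := by
    refine Set.eq_empty_of_forall_notMem ?_
    rintro t ⟨ht, hty⟩
    have := hω.mul_le_telegraph (m := 0) (fun j => (hγ j).le) hτ ht.le
    linarith
  rw [firstPassage, this, Set.image_empty, sInf_empty]

section SameSign

variable {γ : Fin 2 → ℝ} {y : ℝ}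

theorem mem_uIcc_iff_xi_nonneg (hγ : ∀ j, 0 < γ j) (hne : γ 0 ≠ γ 1) (hy : 0 < y) (t : ℝ) :
    t ∈ Set.uIcc (y / γ 0) (y / γ 1) ↔ 0 ≤ xi γ 0 t y ∧ 0 ≤ xi γ 1 t y := by
  have h0 := hγ 0
  have h1 := hγ 1
  change _ ↔ 0 ≤ (y - γ 1 * t) / (γ 0 - γ 1) ∧ 0 ≤ (γ 0 * t - y) / (γ 0 - γ 1)
  rcases lt_or_gt_of_ne hne with h | h
  · rw [Set.uIcc_of_ge ((div_le_div_iff_of_pos_left hy h1 h0).2 h.le), Set.mem_Icc,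
      le_div_iff_of_neg (sub_neg.2 h), le_div_iff_of_neg (sub_neg.2 h), zero_mul,
      div_le_iff₀' h1, le_div_iff₀' h0, sub_nonpos, sub_nonpos]
  · rw [Set.uIcc_of_le ((div_le_div_iff_of_pos_left hy h0 h1).2 h.le), Set.mem_Icc,
      le_div_iff₀ (sub_pos.2 h), le_div_iff₀ (sub_pos.2 h), zero_mul,
      div_le_iff₀' h0, le_div_iff₀' h1, sub_nonneg, sub_nonneg, and_comm]

theorem xi_and_xi_symm (i : Fin 2) (t : ℝ) (p : ℝ → Prop) :
    (p (xi γ i t y) ∧ p (xi γ (1 - i) t y)) ↔ (p (xi γ 0 t y) ∧ p (xi γ 1 t y)) := by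
  fin_cases i
  · rfl
  · exact and_comm

/-- Closed and open conditions on the time differ on a Lebesgue null set. -/
theorem setLIntegral_indicator_uIcc (hγ : ∀ j, 0 < γ j) (hne : γ 0 ≠ γ 1) (hy : 0 < y)
    (i : Fin 2) (f : ℝ → ℝ) (A : Set ℝ) :
    ∫⁻ t in A, ENNReal.ofReal ((Set.uIcc (y / γ 0) (y / γ 1)).indicator f t) =
      ∫⁻ t in A, ENNReal.ofReal (if 0 < xi γ i t y ∧ 0 < xi γ (1 - i) t y then f t else 0) := by
  refine lintegral_congr_ae (ae_restrict_of_ae ?_)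
  filter_upwards [ae_xi_ne_zero hne (i := 0) (hγ _).ne' y,
    ae_xi_ne_zero hne (i := 1) (hγ _).ne' y] with t h0 h1
  simp only [Set.indicator, mem_uIcc_iff_xi_nonneg hγ hne hy, xi_and_xi_symm i t (fun x => 0 < x),
    h0.symm.le_iff_lt, h1.symm.le_iff_lt]

theorem passageEvent_disjoint (γ : Fin 2 → ℝ) (i : Fin 2) (y : ℝ) (A : Set ℝ) :
    Pairwise (Function.onFun Disjoint fun n => passageEvent γ n i y A) := by
  have h : ∀ m n, m < n → Disjoint (passageEvent γ m i y A) (passageEvent γ n i y A) := by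
    refine fun m n hmn => Set.disjoint_left.2 fun d hm hn => ?_
    exact lt_asymm hm.2.1 (hn.1 (m + 1) hmn)
  intro m n hmn
  rcases lt_or_gt_of_ne hmn with hlt | hlt
  · exact h m n hlt
  · exact (h n m hlt).symm

theorem ae_mem_passageIn_uIcc (hlam : ∀ i, 0 < lam i) (hε : IsSwitchingProcess P lam ε τ)
    (hγ : ∀ j, 0 < γ j) (hne : γ 0 ≠ γ 1) (hy : 0 < y) {i : Fin 2}
    (hi : P {ω | ε 0 ω = i} ≠ 0) :
    ∀ᵐ ω ∂condStart P ε i, ω ∈ passageIn γ ε y (Set.uIcc (y / γ 0) (y / γ 1)) := by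
  filter_upwards [ae_condStart_isRegularPath hlam hε hi, ae_condStart_tendsto hlam hε hi,
    ae_gaps hε hi (ae_holdingLaw_pathSum_ne hlam (fun j => (hγ j).ne') i y)] with ω hω hτ hturn
  obtain ⟨n, hn⟩ := hω.exists_mem_passageEvent hγ hτ hy hturn
  obtain ⟨t, -, ht0, hty, hT, -⟩ := hω.exists_of_mem_passageEvent hn
  refine ⟨t, ?_, hT⟩
  have hlow : ∀ m : ℝ, (∀ j, m ≤ γ j) → m * t ≤ y := fun m hm =>
    hty ▸ hω.mul_le_telegraph hm hτ ht0.le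
  have hupp : ∀ M : ℝ, (∀ j, γ j ≤ M) → y ≤ M * t := fun M hM => by
    have := hω.mul_le_telegraph (γ := -γ) (m := -M) (fun j => neg_le_neg (hM j)) hτ ht0.le
    rw [telegraph_neg, hty] at this
    linarith
  rw [mem_uIcc_iff_xi_nonneg hγ hne hy]
  change 0 ≤ (y - γ 1 * t) / (γ 0 - γ 1) ∧ 0 ≤ (γ 0 * t - y) / (γ 0 - γ 1)
  rcases le_total (γ 0) (γ 1) with h | h
  · have h1 := hlow (γ 0) (fun j => by fin_cases j <;> simp [h])
    have h2 := hupp (γ 1) (fun j => by fin_cases j <;> simp [h])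
    exact ⟨div_nonneg_of_nonpos (by linarith) (by linarith),
      div_nonneg_of_nonpos (by linarith) (by linarith)⟩
  · have h1 := hlow (γ 1) (fun j => by fin_cases j <;> simp [h])
    have h2 := hupp (γ 0) (fun j => by fin_cases j <;> simp [h])
    exact ⟨div_nonneg (by linarith) (by linarith), div_nonneg (by linarith) (by linarith)⟩

theorem condStart_passageIn_eq_tsum (hlam : ∀ i, 0 < lam i) (hε : IsSwitchingProcess P lam ε τ)
    (hγ : ∀ j, 0 < γ j) (hy : 0 < y) {i : Fin 2}
    (hi : P {ω | ε 0 ω = i} ≠ 0) {A : Set ℝ} (hA : MeasurableSet A) :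
    condStart P ε i (passageIn γ ε y A) = ∑' n, holdingLaw lam i (passageEvent γ n i y A) := by
  rw [← measure_iUnion (passageEvent_disjoint γ i y A)
      (fun n => measurableSet_passageEvent γ n i y hA),
    ← map_gaps hε hi, Measure.map_apply (measurable_gaps hε)
    (MeasurableSet.iUnion fun n => measurableSet_passageEvent γ n i y hA)]
  refine measure_congr (Filter.eventuallyEq_set.2 ?_)
  filter_upwards [passageInWith_ae_iff hlam hε (fun j => (hγ j).ne') hy hi,
    ae_condStart_isRegularPath hlam hε hi, ae_condStart_tendsto hlam hε hi,
    ae_gaps hε hi (ae_holdingLaw_pathSum_ne hlam (fun j => (hγ j).ne') i y)]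
    with ω hiff hω hτ hturn
  rw [Set.mem_preimage, Set.mem_iUnion]
  constructor
  · rintro ⟨t, htA, hT⟩
    obtain ⟨n, hn⟩ := hω.exists_mem_passageEvent hγ hτ hy hturn
    obtain ⟨t', -, hT', hN⟩ := (hiff _ _).2 hn
    have : t = t' := EReal.coe_eq_coe_iff.1 (hT.symm.trans hT')
    exact ⟨n, (hiff A n).1 ⟨t, htA, hT, this ▸ hN⟩⟩
  · rintro ⟨n, hn⟩
    obtain ⟨t, htA, hT, -⟩ := (hiff A n).2 hn
    exact ⟨t, htA, hT⟩

theorem hasSum_besselSum0 (z : ℝ) :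
    HasSum (fun n : ℕ => z ^ n / (n.factorial : ℝ) ^ 2) (besselSum0 z) := by
  refine Summable.hasSum (Summable.of_norm_bounded (Real.summable_pow_div_factorial |z|) ?_)
  intro n
  have h1 : (1 : ℝ) ≤ n.factorial := by exact_mod_cast n.factorial_pos
  rw [Real.norm_eq_abs, abs_div, abs_pow, abs_of_nonneg (by positivity : (0:ℝ) ≤ n.factorial ^ 2)]
  refine div_le_div_of_nonneg_left (by positivity) (by positivity) ?_
  nlinarith

theorem hasSum_besselSum1 (z : ℝ) :
    HasSum (fun n : ℕ => z ^ n / ((n.factorial : ℝ) * ((n + 1).factorial : ℝ)))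
      (besselSum1 z) := by
  refine Summable.hasSum (Summable.of_norm_bounded (Real.summable_pow_div_factorial |z|) ?_)
  intro n
  have h1 : (1 : ℝ) ≤ (n + 1).factorial := by exact_mod_cast (n + 1).factorial_pos
  rw [Real.norm_eq_abs, abs_div, abs_pow,
    abs_of_nonneg (by positivity : (0:ℝ) ≤ n.factorial * (n + 1).factorial)]
  refine div_le_div_of_nonneg_left (by positivity) (by positivity) ?_
  exact le_mul_of_one_le_right (by positivity) h1

theorem oddDensity_nonneg (hlam : ∀ i, 0 < lam i) (hγ : ∀ j, 0 < γ j) (hne : γ 0 ≠ γ 1) (m : ℕ)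
    (i : Fin 2) (t y : ℝ) : 0 ≤ oddDensity lam γ m i t y := by
  unfold oddDensity
  split_ifs with h
  · have hθ := absTheta_pos lam hne t y
    have := hlam 0
    have := hlam 1
    have := hlam i
    have := hγ (1 - i)
    have := h.1
    have := h.2
    rw [zfun_eq lam γ i]
    positivity
  · exact le_rfl

theorem evenDensity_nonneg (hlam : ∀ i, 0 < lam i) (hγ : ∀ j, 0 < γ j) (hne : γ 0 ≠ γ 1) (m : ℕ)
    (i : Fin 2) (t y : ℝ) : 0 ≤ evenDensity lam γ m i t y := by
  unfold evenDensity
  split_ifs with h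
  · have hθ := absTheta_pos lam hne t y
    have := hlam 0
    have := hlam 1
    have := hγ i
    have := h.1
    have := h.2
    rw [zfun_eq lam γ i]
    positivity
  · exact le_rfl

/-- Summation over the number of switchings produces the two Bessel series. -/
theorem tsum_density (hlam : ∀ i, 0 < lam i) (hγ : ∀ j, 0 < γ j) (hne : γ 0 ≠ γ 1)
    (i : Fin 2) (t y : ℝ) :
    ∑' m, ENNReal.ofReal (oddDensity lam γ m i t y) +
      ∑' m, ENNReal.ofReal (evenDensity lam γ m i t y) =
    ENNReal.ofReal (if 0 < xi γ i t y ∧ 0 < xi γ (1 - i) t y then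
      lam i * (γ (1 - i) * besselSum0 (zfun lam γ t y)
        + lam (1 - i) * γ i * xi γ i t y * besselSum1 (zfun lam γ t y)) * absTheta lam γ t y
      else 0) := by
  have ho := oddDensity_nonneg hlam hγ hne
  have he := evenDensity_nonneg hlam hγ hne
  by_cases h : 0 < xi γ i t y ∧ 0 < xi γ (1 - i) t y
  · have h1 : HasSum (fun m => oddDensity lam γ m i t y)
        (lam i * γ (1 - i) * besselSum0 (zfun lam γ t y) * absTheta lam γ t y) := by
      simp only [oddDensity, if_pos h]
      exact ((hasSum_besselSum0 _).mul_left _).mul_right _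
    have h2 : HasSum (fun m => evenDensity lam γ m i t y)
        (lam 0 * lam 1 * γ i * xi γ i t y * besselSum1 (zfun lam γ t y) * absTheta lam γ t y) := by
      simp only [evenDensity, if_pos h]
      exact ((hasSum_besselSum1 _).mul_left _).mul_right _
    rw [← ENNReal.ofReal_tsum_of_nonneg (fun m => ho m i t y) h1.summable,
      ← ENNReal.ofReal_tsum_of_nonneg (fun m => he m i t y) h2.summable, h1.tsum_eq, h2.tsum_eq,
      ← ENNReal.ofReal_add (h1.nonneg fun m => ho m i t y) (h2.nonneg fun m => he m i t y),
      if_pos h, ← rate_mul_rate lam i]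
    congr 1
    ring
  · simp [oddDensity, evenDensity, h]

/-- The distribution of the first passage time for two distinct velocities of the sign of the
level, taken positive here. The order of the velocities is left open, so that the case of negative
velocities follows by reflection. -/
theorem passage_law_of_pos [IsProbabilityMeasure P] (hlam : ∀ i, 0 < lam i)
    (hε : IsSwitchingProcess P lam ε τ)
    (hγ : ∀ j, 0 < γ j) (hne : γ 0 ≠ γ 1) (hy : 0 < y) :
    (∃ C : ℝ, ∀ᵐ ω ∂P, firstPassage γ ε y ω ≤ (C : EReal)) ∧
    (∀ᵐ ω ∂P, ω ∈ passageIn γ ε y (Set.uIcc (y / γ 0) (y / γ 1))) ∧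
    ∀ i : Fin 2, P {ω | ε 0 ω = i} ≠ 0 →
      {t : ℝ | ∀ U ∈ nhds t, condStart P ε i (passageIn γ ε y U) ≠ 0}
        = Set.uIcc (y / γ 0) (y / γ 1) ∧
      ∀ A : Set ℝ, MeasurableSet A →
        condStart P ε i (passageInWith γ ε τ y A 0)
          = ENNReal.ofReal (Real.exp (-lam i * (y / γ i))) * Measure.dirac (y / γ i) A ∧
        (∀ n : ℕ, condStart P ε i (passageInWith γ ε τ y A (2 * n + 1))
          = ∫⁻ t in A, ENNReal.ofReal ((Set.uIcc (y / γ 0) (y / γ 1)).indicator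
              (fun t => lam i * |γ (1 - i)| * (zfun lam γ t y ^ n / (n.factorial : ℝ) ^ 2)
                * absTheta lam γ t y) t)) ∧
        (∀ n : ℕ, condStart P ε i (passageInWith γ ε τ y A (2 * n + 2))
          = ∫⁻ t in A, ENNReal.ofReal ((Set.uIcc (y / γ 0) (y / γ 1)).indicator
              (fun t => lam 0 * lam 1 * |γ i| * xi γ i t y
                * (zfun lam γ t y ^ n / ((n.factorial : ℝ) * ((n + 1).factorial : ℝ)))
                * absTheta lam γ t y) t)) ∧
        condStart P ε i (passageIn γ ε y A)
          = ENNReal.ofReal (Real.exp (-lam i * (y / γ i))) * Measure.dirac (y / γ i) A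
            + ∫⁻ t in A, ENNReal.ofReal ((Set.uIcc (y / γ 0) (y / γ 1)).indicator
              (fun t => lam i * (|γ (1 - i)| * besselSum0 (zfun lam γ t y)
                  + lam (1 - i) * |γ i| * xi γ i t y * besselSum1 (zfun lam γ t y))
                * absTheta lam γ t y) t) := by
  have hmem : ∀ᵐ ω ∂P, ω ∈ passageIn γ ε y (Set.uIcc (y / γ 0) (y / γ 1)) :=
    ae_of_forall_condStart hε fun i hi => ae_mem_passageIn_uIcc hlam hε hγ hne hy hi
  have hγ0 : ∀ j, γ j ≠ 0 := fun j => (hγ j).ne'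
  refine ⟨⟨max (y / γ 0) (y / γ 1), ?_⟩, hmem, fun i hi => ?_⟩
  · filter_upwards [hmem] with ω ⟨t, ht, hT⟩
    rw [hT]
    exact EReal.coe_le_coe_iff.2 ht.2
  have habs : ∀ j, |γ j| = γ j := fun j => abs_of_pos (hγ j)
  have hodd : ∀ A, MeasurableSet A → ∀ n : ℕ,
      condStart P ε i (passageInWith γ ε τ y A (2 * n + 1))
        = ∫⁻ t in A, ENNReal.ofReal ((Set.uIcc (y / γ 0) (y / γ 1)).indicator
            (fun t => lam i * γ (1 - i) * (zfun lam γ t y ^ n / (n.factorial : ℝ) ^ 2)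
              * absTheta lam γ t y) t) := fun A hA n => by
    rw [setLIntegral_indicator_uIcc hγ hne hy i, condStart_passageInWith hlam hε hγ0 hy hi hA]
    exact holdingLaw_passageEvent_odd hlam hγ hne n i y hA
  simp only [habs]
  refine ⟨?_, fun A hA => ⟨?_, hodd A hA, fun n => ?_, ?_⟩⟩
  · refine Set.Subset.antisymm (fun t ht => ?_) (fun t ht U hU hzero => ?_)
    · by_contra hout
      refine ht _ (isClosed_Icc.isOpen_compl.mem_nhds hout) ?_
      rw [measure_eq_zero_iff_ae_notMem]
      filter_upwards [ae_mem_passageIn_uIcc hlam hε hγ hne hy hi] with ω ⟨s, hs, hsT⟩ ⟨u, hu, huT⟩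
      have : s = u := EReal.coe_eq_coe_iff.1 (hsT.symm.trans huT)
      exact hu (this ▸ hs)
    · -- one switching already charges every relatively open part of the segment
      obtain ⟨V, hVU, hV, htV⟩ := mem_nhds_iff.1 hU
      have h0 : condStart P ε i (passageInWith γ ε τ y V (2 * (0 : ℕ) + 1)) = 0 := by
        refine measure_mono_null ?_ hzero
        rintro ω ⟨s, hs, hsT, -⟩
        exact ⟨s, hVU hs, hsT⟩
      have hlt : min (y / γ 0) (y / γ 1) < max (y / γ 0) (y / γ 1) := by
        rw [min_lt_max]
        intro h
        rw [div_eq_div_iff (hγ0 0) (hγ0 1)] at h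
        exact hne (mul_left_cancel₀ hy.ne' h).symm
      have hpos : 0 < volume (V ∩ Set.Ioo (min (y / γ 0) (y / γ 1)) (max (y / γ 0) (y / γ 1))) := by
        refine (hV.inter isOpen_Ioo).measure_pos volume ?_
        have : t ∈ closure (Set.Ioo (min (y / γ 0) (y / γ 1)) (max (y / γ 0) (y / γ 1))) := by
          rw [closure_Ioo hlt.ne]
          exact ht
        exact mem_closure_iff.1 this V hV htV
      have hm : Measurable fun t => ENNReal.ofReal (oddDensity lam γ 0 i t y) :=
        (measurable_oddDensity lam γ 0 i).comp (measurable_id.prodMk measurable_const)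
      rw [hodd V hV.measurableSet 0, setLIntegral_indicator_uIcc hγ hne hy i] at h0
      have h1 : ∫⁻ t in V, ENNReal.ofReal (oddDensity lam γ 0 i t y) = 0 := h0
      rw [lintegral_eq_zero_iff hm, Filter.EventuallyEq, ae_restrict_iff' hV.measurableSet] at h1
      refine hpos.ne' (measure_eq_zero_iff_ae_notMem.2 ?_)
      filter_upwards [h1, ae_xi_ne_zero hne (i := 0) (hγ _).ne' y,
        ae_xi_ne_zero hne (i := 1) (hγ _).ne' y] with s hs h2 h3 hsV
      have hs' := (mem_uIcc_iff_xi_nonneg hγ hne hy s).1 (Set.Ioo_subset_Icc_self hsV.2)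
      have hs'' := (xi_and_xi_symm i s (fun x => 0 < x)).2
        ⟨hs'.1.lt_of_ne' h2, hs'.2.lt_of_ne' h3⟩
      have := hs hsV.1
      simp only [oddDensity, if_pos hs'', Pi.zero_apply, ENNReal.ofReal_eq_zero] at this
      have hθ := absTheta_pos lam hne s y
      have := hlam i
      have := hγ (1 - i)
      have : 0 < lam i * γ (1 - i) * (zfun lam γ s y ^ 0 / ((0 : ℕ).factorial : ℝ) ^ 2) *
          absTheta lam γ s y := by
        rw [pow_zero]
        positivity
      linarith
  · rw [condStart_passageInWith hlam hε hγ0 hy hi hA,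
      holdingLaw_passageEvent_zero hlam γ i hy, if_pos (hγ i)]
  · rw [setLIntegral_indicator_uIcc hγ hne hy i, condStart_passageInWith hlam hε hγ0 hy hi hA]
    exact holdingLaw_passageEvent_even hlam hγ hne n i y hA
  · have hmo : ∀ m, Measurable fun t => ENNReal.ofReal (oddDensity lam γ m i t y) := fun m =>
      (measurable_oddDensity lam γ m i).comp (measurable_id.prodMk measurable_const)
    have hme : ∀ m, Measurable fun t => ENNReal.ofReal (evenDensity lam γ m i t y) := fun m =>
      (measurable_evenDensity lam γ m i).comp (measurable_id.prodMk measurable_const)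
    rw [setLIntegral_indicator_uIcc hγ hne hy i, condStart_passageIn_eq_tsum hlam hε hγ hy hi hA,
      tsum_eq_zero_add' ENNReal.summable, holdingLaw_passageEvent_zero hlam γ i hy, if_pos (hγ i),
      ← tsum_even_add_odd ENNReal.summable ENNReal.summable]
    congr 1
    simp only [← tsum_density hlam hγ hne]
    rw [lintegral_add_left (Measurable.tsum hmo),
      lintegral_tsum fun m => (hmo m).aemeasurable, lintegral_tsum fun m => (hme m).aemeasurable]
    congr 1
    · exact tsum_congr fun m => holdingLaw_passageEvent_odd hlam hγ hne m i y hA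
    · exact tsum_congr fun m => holdingLaw_passageEvent_even hlam hγ hne m i y hA

end SameSign

end ProcessLaw

/-! ### Reflection and descending states -/

/-- A level above the path cannot be crossed while the velocity is negative. -/
theorem holdingLaw_passageEvent_of_neg {lam γ : Fin 2 → ℝ} (hlam : ∀ i, 0 < lam i) {n : ℕ}
    {i : Fin 2} (hγ : γ (stateAfter i n) < 0) (y : ℝ) (A : Set ℝ) :
    holdingLaw lam i (passageEvent γ n i y A) = 0 := by
  refine measure_mono_null ?_ (ae_iff.1 (ae_holdingLaw_pos hlam i))
  rintro d ⟨hd, hd', -⟩ hpos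
  rw [pathSum_succ] at hd'
  nlinarith [hpos n, hd n le_rfl]

theorem xi_neg (γ : Fin 2 → ℝ) (i : Fin 2) (t y : ℝ) : xi (-γ) i t (-y) = xi γ i t y := by
  rw [xi_eq, xi_eq, ← neg_div_neg_eq]
  simp only [Pi.neg_apply]
  ring

theorem zfun_neg (lam γ : Fin 2 → ℝ) (t y : ℝ) : zfun lam (-γ) t (-y) = zfun lam γ t y := by
  simp only [zfun, xi_neg]

theorem absTheta_neg (lam γ : Fin 2 → ℝ) (t y : ℝ) :
    absTheta lam (-γ) t (-y) = absTheta lam γ t y := by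
  simp only [absTheta, xi_neg, Pi.neg_apply]
  rw [← abs_neg (γ 0 - γ 1)]
  congr 2
  ring

theorem theta_eq_absTheta (lam : Fin 2 → ℝ) {γ : Fin 2 → ℝ} (h : γ 1 < γ 0) :
    theta lam γ = absTheta lam γ := by
  funext t y
  rw [theta, absTheta, abs_of_pos (sub_pos.2 h)]

theorem xi_one_pos_iff {γ : Fin 2 → ℝ} (h0 : 0 < γ 0) (h1 : γ 1 < 0) (t y : ℝ) :
    0 < xi γ 1 t y ↔ t ∈ Set.Ioi (y / γ 0) := by
  change 0 < (γ 0 * t - y) / (γ 0 - γ 1) ↔ _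
  rw [div_pos_iff_of_pos_right (by linarith), Set.mem_Ioi, div_lt_iff₀' h0, sub_pos]

theorem upEvenDensity_eq_indicator (lam : Fin 2 → ℝ) {γ : Fin 2 → ℝ} (h0 : 0 < γ 0) (h1 : γ 1 < 0)
    {y : ℝ} (hy : 0 < y) (n : ℕ) (t : ℝ) :
    upEvenDensity lam γ n t y = (Set.Ioi (y / γ 0)).indicator
      (fun t => lam 0 * lam 1 * y
        * (zfun lam γ t y ^ n / ((n.factorial : ℝ) * ((n + 1).factorial : ℝ)))
        * theta lam γ t y) t := by
  simp only [upEvenDensity, xi_one_pos_iff h0 h1, hy, and_true, Set.indicator,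
    theta_eq_absTheta lam (h1.trans h0)]

theorem upOddDensity_eq_indicator (lam : Fin 2 → ℝ) {γ : Fin 2 → ℝ} (h0 : 0 < γ 0) (h1 : γ 1 < 0)
    {y : ℝ} (hy : 0 < y) (n : ℕ) (t : ℝ) :
    upOddDensity lam γ n t y = (Set.Ioi (y / γ 0)).indicator
      (fun t => lam 1 / xi γ 0 t y * (zfun lam γ t y ^ n / (n.factorial : ℝ) ^ 2)
        * theta lam γ t y * (y - γ 1 / (n + 1) * xi γ 1 t y)) t := by
  by_cases ht : t ∈ Set.Ioi (y / γ 0)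
  swap
  · simp only [upOddDensity, xi_one_pos_iff h0 h1, ht, false_and, if_false, Set.indicator]
  have hq := (xi_one_pos_iff h0 h1 t y).2 ht
  rw [upOddDensity, if_pos ⟨hq, hy⟩, Set.indicator_of_mem ht, theta_eq_absTheta lam (h1.trans h0)]
  have hpq : γ 0 * xi γ 0 t y + γ 1 * xi γ 1 t y = y :=
    velocity_mul_xi_add (h1.trans h0).ne' 0 t y
  set p := xi γ 0 t y with hp
  set q := xi γ 1 t y
  have hp0 : p ≠ 0 := by
    intro h
    rw [h] at hpq
    nlinarith
  have hz : zfun lam γ t y = lam 0 * lam 1 * q * p := by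
    change lam 0 * lam 1 * p * q = _
    ring
  have hn : (n : ℝ) + 1 ≠ 0 := by positivity
  have hpn : (n : ℝ) * p ^ (n - 1) = n * p ^ n / p := by
    cases n with
    | zero => simp
    | succ k => rw [Nat.add_sub_cancel, pow_succ, ← mul_assoc, mul_div_cancel_right₀ _ hp0]
  have hpow : γ 1 * q * (n / (n + 1)) * p ^ (n - 1) = γ 1 * q / (n + 1) * (n * p ^ n / p) := by
    rw [← hpn]
    ring
  have hy' : y - γ 1 / (n + 1) * q = γ 0 * p + γ 1 * q / (n + 1) * n := by
    field_simp
    linear_combination (-(n : ℝ) - 1) * hpq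
  rw [hpow, hy', hz, mul_pow _ p]
  field_simp

/-! ### The distribution of the first passage time -/

theorem theorem1 {Ω : Type*} [MeasurableSpace Ω] (P : Measure Ω) [IsProbabilityMeasure P]
    (lam γ : Fin 2 → ℝ) (hlam : ∀ i, 0 < lam i) (ε : ℝ → Ω → Fin 2) (τ : ℕ → Ω → ℝ)
    (hε : IsSwitchingProcess P lam ε τ) (y : ℝ) :
    -- the level and both velocities have the same sign
    (((0 < y ∧ 0 < γ 1 ∧ γ 1 < γ 0) ∨ (y < 0 ∧ γ 0 < 0 ∧ γ 1 < γ 0)) →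
      (∃ C : ℝ, ∀ᵐ ω ∂P, firstPassage γ ε y ω ≤ (C : EReal)) ∧
      (∀ᵐ ω ∂P, ω ∈ passageIn γ ε y (Set.uIcc (y / γ 0) (y / γ 1))) ∧
      ∀ i : Fin 2, P {ω | ε 0 ω = i} ≠ 0 →
        -- the support of the distribution of the first passage time
        {t : ℝ | ∀ U ∈ nhds t, condStart P ε i (passageIn γ ε y U) ≠ 0}
          = Set.uIcc (y / γ 0) (y / γ 1) ∧
        ∀ A : Set ℝ, MeasurableSet A →
          -- no switching
          condStart P ε i (passageInWith γ ε τ y A 0)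
            = ENNReal.ofReal (Real.exp (-lam i * (y / γ i))) * Measure.dirac (y / γ i) A ∧
          -- an odd number of switchings
          (∀ n : ℕ, condStart P ε i (passageInWith γ ε τ y A (2 * n + 1))
            = ∫⁻ t in A, ENNReal.ofReal ((Set.uIcc (y / γ 0) (y / γ 1)).indicator
                (fun t => lam i * |γ (1 - i)| * (zfun lam γ t y ^ n / (n.factorial : ℝ) ^ 2)
                  * theta lam γ t y) t)) ∧
          -- a positive even number of switchings
          (∀ n : ℕ, condStart P ε i (passageInWith γ ε τ y A (2 * n + 2))
            = ∫⁻ t in A, ENNReal.ofReal ((Set.uIcc (y / γ 0) (y / γ 1)).indicator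
                (fun t => lam 0 * lam 1 * |γ i| * xi γ i t y
                  * (zfun lam γ t y ^ n / ((n.factorial : ℝ) * ((n + 1).factorial : ℝ)))
                  * theta lam γ t y) t)) ∧
          -- the distribution of the first passage time
          condStart P ε i (passageIn γ ε y A)
            = ENNReal.ofReal (Real.exp (-lam i * (y / γ i))) * Measure.dirac (y / γ i) A
              + ∫⁻ t in A, ENNReal.ofReal ((Set.uIcc (y / γ 0) (y / γ 1)).indicator
                (fun t => lam i * (|γ (1 - i)| * besselSum0 (zfun lam γ t y)
                    + lam (1 - i) * |γ i| * xi γ i t y * besselSum1 (zfun lam γ t y))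
                  * theta lam γ t y) t)) ∧
    -- the level is never reached
    (((y < 0 ∧ 0 < γ 1 ∧ γ 1 ≤ γ 0) ∨ (0 < y ∧ γ 0 < 0 ∧ γ 1 ≤ γ 0)) →
      ∀ᵐ ω ∂P, firstPassage γ ε y ω = ⊤) ∧
    -- velocities of opposite signs, positive level
    ((0 < γ 0 ∧ γ 1 < 0 ∧ 0 < y) →
      -- starting from the state 0
      (P {ω | ε 0 ω = 0} ≠ 0 →
        ∀ A : Set ℝ, MeasurableSet A →
          condStart P ε 0 (passageInWith γ ε τ y A 0)
            = ENNReal.ofReal (Real.exp (-lam 0 * (y / γ 0))) * Measure.dirac (y / γ 0) A ∧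
          (∀ n : ℕ, condStart P ε 0 (passageInWith γ ε τ y A (2 * n + 1)) = 0) ∧
          (∀ n : ℕ, condStart P ε 0 (passageInWith γ ε τ y A (2 * n + 2))
            = ∫⁻ t in A, ENNReal.ofReal ((Set.Ioi (y / γ 0)).indicator
                (fun t => lam 0 * lam 1 * y
                  * (zfun lam γ t y ^ n / ((n.factorial : ℝ) * ((n + 1).factorial : ℝ)))
                  * theta lam γ t y) t))) ∧
      -- starting from the state 1
      (P {ω | ε 0 ω = 1} ≠ 0 →
        ∀ A : Set ℝ, MeasurableSet A →
          condStart P ε 1 (passageInWith γ ε τ y A 0) = 0 ∧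
          (∀ n : ℕ, condStart P ε 1 (passageInWith γ ε τ y A (2 * n + 1))
            = ∫⁻ t in A, ENNReal.ofReal ((Set.Ioi (y / γ 0)).indicator
                (fun t => lam 1 / xi γ 0 t y * (zfun lam γ t y ^ n / (n.factorial : ℝ) ^ 2)
                  * theta lam γ t y * (y - γ 1 / (n + 1) * xi γ 1 t y)) t)) ∧
          (∀ n : ℕ, condStart P ε 1 (passageInWith γ ε τ y A (2 * n + 2)) = 0))) := by
  refine ⟨?_, ?_, ?_⟩
  · rintro (⟨hy, h1, h⟩ | ⟨hy, h0, h⟩)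
    · rw [theta_eq_absTheta lam h]
      refine passage_law_of_pos hlam hε (fun j => ?_) h.ne' hy
      fin_cases j
      · exact h1.trans h
      · exact h1
    · have key := passage_law_of_pos (γ := -γ) (y := -y) hlam hε (fun j => by
        fin_cases j
        · exact neg_pos.2 h0
        · exact neg_pos.2 (h.trans h0)) (fun h' => h.ne' (neg_inj.1 h')) (neg_pos.2 hy)
      rw [theta_eq_absTheta lam h]
      simpa only [firstPassage_neg, passageIn_neg, passageInWith_neg, xi_neg, zfun_neg,
        absTheta_neg, Pi.neg_apply, abs_neg, neg_div_neg_eq] using key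
  · rintro (⟨hy, h1, h⟩ | ⟨hy, h0, h⟩)
    · refine ae_firstPassage_eq_top hlam hε (fun j => ?_) hy
      fin_cases j
      · exact h1.trans_le h
      · exact h1
    · have key := ae_firstPassage_eq_top (γ := -γ) (y := -y) hlam hε (fun j => by
        fin_cases j
        · exact neg_pos.2 h0
        · exact neg_pos.2 (h.trans_lt h0)) (neg_lt_zero.2 hy)
      simpa only [firstPassage_neg] using key
  · rintro ⟨h0, h1, hy⟩
    have hγ : ∀ j, γ j ≠ 0 := fun j => by
      fin_cases j
      · exact h0.ne'
      · exact h1.ne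
    refine ⟨fun hi A hA => ⟨?_, fun n => ?_, fun n => ?_⟩,
      fun hi A hA => ⟨?_, fun n => ?_, fun n => ?_⟩⟩
    · rw [condStart_passageInWith hlam hε hγ hy hi hA, holdingLaw_passageEvent_zero hlam γ 0 hy,
        if_pos h0]
    · rw [condStart_passageInWith hlam hε hγ hy hi hA]
      exact holdingLaw_passageEvent_of_neg hlam (by simpa [stateAfter] using h1) y A
    · rw [condStart_passageInWith hlam hε hγ hy hi hA,
        holdingLaw_passageEvent_up_even hlam h0 h1 n y hA]
      simp only [upEvenDensity_eq_indicator lam h0 h1 hy]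
    · rw [condStart_passageInWith hlam hε hγ hy hi hA]
      exact holdingLaw_passageEvent_of_neg hlam (by simpa [stateAfter] using h1) y A
    · rw [condStart_passageInWith hlam hε hγ hy hi hA,
        holdingLaw_passageEvent_up_odd hlam h0 h1 n y hA]
      simp only [upOddDensity_eq_indicator lam h0 h1 hy]
    · rw [condStart_passageInWith hlam hε hγ hy hi hA]
      exact holdingLaw_passageEvent_of_neg hlam
        (by simpa [stateAfter, Nat.even_add] using h1) y A
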